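/- Let $d\ge 1$ and $Y_i=g(X_i)+\sigma(X_i)e_i$, $i\ge1$, where $(X_i)$ is an i.i.d. sequence in $\mathbb R^d$, $(e_i)$ is an i.i.d. sequence of real random variables independent of $(X_i)$ with $\mathbb E[e_1]=0$ and $\mathbb E[e_1^2]<\infty$, and $g,\sigma:\mathbb R^d\to\mathbb R$ are measurable. Let $r\in\mathbb N$, let $\psi:\mathbb R^d\to\mathbb R$ be a function that is differentiable almost everywhere, with gradient $\nabla\psi$ (to which arbitrary values may be assigned on a Lebesgue-null set), and let $Q\subset\mathbb R^d$ be nonempty, bounded and convex. Assume: (i) $X_1$ has a bounded density $f$ on $\mathbb R^d$ which is $r$ times differentiable with bounded $r$-th order derivatives; (ii) there is $b>0$ with $f(x)\ge b$ for every $x\in Q$; (iii) the kernel $K:\mathbb R^d\to\mathbb R$ is measurable, symmetric ($K(-u)=K(u)$) and of order $r$, i.e. $\int K(u)\,du=1$ and $\int u_1^{l_1}\cdots u_d^{l_d}K(u)\,du=0$ for all $l\in\mathbb N^d$ with $1\le l_1+\dots+l_d\le r-1$, and $|K(x)|\le C_1\exp(-C_2\|x\|)$ for all $x\in\mathbb R^d$,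 for some constants $C_1$ and $C_2>0$; (iv) $\nabla\psi$ vanishes outside $Q$ (for instance, $Q$ is the support of $\nabla\psi$) and is Hölder on $Q$; (v) $g$ is Hölder on $Q$ and $\sigma$ is bounded; (vi) the bandwidth $h=h_n>0$ satisfies $n^{1/2}h^r\to0$ and $n^{1/2}h^d\to+\infty$ as $n\to\infty$. Let $$\widehat f^{(i)}(x)=\frac1{nh^d}\sum_{j\ne i,\ 1\le j\le n}K\!\left(h^{-1}(X_j-x)\right),\qquad \widehat\beta_\psi=\frac1n\sum_{i=1}^n\frac{Y_i\nabla\psi(X_i)}{\widehat f^{(i)}(X_i)},\qquad \beta_\psi=\int g(x)\nabla\psi(x)\,dx .$$ Then the integral defining $\beta_\psi$ converges absolutely, the random vector $\frac{Y_1-g(X_1)}{f(X_1)}\nabla\psi(X_1)$ is square integrable, and $$n^{1/2}\left(\widehat\beta_\psi-\beta_\psi\right)\overset{\mathrm d}{\longrightarrow}\mathcal N(0,v)\quad\text{as } n\to\infty,$$ where $v$ is the covariance matrix of $\frac{Y_1-g(X_1)}{f(X_1)}\nabla\psi(X_1)$. -/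

import Mathlib

open MeasureTheory ProbabilityTheory Filter Topology
open scoped NNReal ENNReal

/-- `u` is Hölder on the set `s`: `‖u x - u y‖ ≤ C ‖x - y‖ ^ α` for all `x, y ∈ s`, for some
constant `C` and some exponent `0 < α ≤ 1`. -/
def IsHolderOn {E F : Type*} [PseudoEMetricSpace E] [PseudoEMetricSpace F]
    (u : E → F) (s : Set E) : Prop :=
  ∃ C α : ℝ≥0, 0 < α ∧ α ≤ 1 ∧ HolderOnWith C α u s

/-- `f` is `r` times differentiable on the whole space and its `r`-th derivative is bounded
(the `r`-th derivative need not be continuous). -/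
def HasBoundedDerivOfOrder {d : ℕ} (r : ℕ) (f : EuclideanSpace ℝ (Fin d) → ℝ) : Prop :=
  (∀ k < r, Differentiable ℝ (iteratedFDeriv ℝ k f)) ∧
    ∃ M : ℝ, ∀ x, ‖iteratedFDeriv ℝ r f x‖ ≤ M

/-- `K` is a (possibly signed) symmetric kernel on `ℝ^d` of order (at least) `r`, with
exponential decay: it integrates to one and its moments of all orders `1, …, r - 1` vanish.
Measurability and the exponential bound make all these integrals absolutely convergent. -/
structure IsKernelOfOrder {d : ℕ} (r : ℕ) (K : EuclideanSpace ℝ (Fin d) → ℝ) : Prop where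
  measurable : Measurable K
  symmetric : ∀ u, K (-u) = K u
  exp_bound : ∃ C₁ C₂ : ℝ, 0 < C₂ ∧ ∀ u, |K u| ≤ C₁ * Real.exp (-C₂ * ‖u‖)
  integral_eq_one : ∫ u, K u = 1
  moment_eq_zero : ∀ l : Fin d → ℕ, 1 ≤ ∑ i, l i → ∑ i, l i < r →
    ∫ u : EuclideanSpace ℝ (Fin d), (∏ i, u i ^ l i) * K u = 0

/-- The leave-one-out kernel density estimator with bandwidth `h`, built on the sample
`x 0, …, x (n - 1)` without the point `x i`:
`(n h^d)⁻¹ ∑_{j ≠ i} K (h⁻¹ (x j - y))`. -/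
noncomputable def looDensity {d : ℕ} (K : EuclideanSpace ℝ (Fin d) → ℝ) (h : ℝ) (n : ℕ)
    (x : ℕ → EuclideanSpace ℝ (Fin d)) (i : ℕ) (y : EuclideanSpace ℝ (Fin d)) : ℝ :=
  ((n : ℝ) * h ^ d)⁻¹ * ∑ j ∈ (Finset.range n).erase i, K (h⁻¹ • (x j - y))

/-- The average derivative estimator by test functions
`n⁻¹ ∑_{i < n} y i • ∇ψ (x i) / f̂⁽ⁱ⁾ (x i)`, where `G` stands for `∇ψ`. -/
noncomputable def betaHat {d : ℕ} (K : EuclideanSpace ℝ (Fin d) → ℝ) (h : ℝ)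
    (G : EuclideanSpace ℝ (Fin d) → EuclideanSpace ℝ (Fin d)) (n : ℕ)
    (x : ℕ → EuclideanSpace ℝ (Fin d)) (y : ℕ → ℝ) : EuclideanSpace ℝ (Fin d) :=
  (n : ℝ)⁻¹ • ∑ i ∈ Finset.range n, (y i / looDensity K h n x i (x i)) • G (x i)

/-- The covariance matrix of a random vector. -/
noncomputable def covarianceMatrix {d : ℕ} {Ω : Type*} [MeasurableSpace Ω]
    (Z : Ω → EuclideanSpace ℝ (Fin d)) (P : Measure Ω) : Matrix (Fin d) (Fin d) ℝ :=
  Matrix.of fun k l => cov[fun ω => Z ω k, fun ω => Z ω l; P]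

/-! Fix a direction `t` and put `w = ⟨∇ψ, t⟩`, `φ = g w`. In direction `t` the estimator is a noise
sum `n⁻¹ ∑ σ w e / f̂` plus a quadrature `n⁻¹ ∑ φ / f̂`, everything evaluated at the sample points.
The point is that the quadrature approximates `∫ φ` with an error of smaller order than `n^(-1/2)`,
a rate that division by the true density does not give in general. Only the noise survives in the
limit.

To see this, expand `1 / f̂ = 2 / f - f̂ / f² + O((f̂ - f)²)` where `f ≥ b`. The mean square error
of `f̂` is of order `1 / (n h^d) + (h^r + 1 / n)²`, so the remainder stays negligible after
multiplication by `√n` (`SmoothingModel.tendstoInMeasure_linearization`). In the linear part, `n⁻¹ ∑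
φ f̂ / f²` is a U-statistic of order two. Its Hoeffding projections are `φ / f²` times the smoothed
`f`, and the smoothed `φ / f`; both approach `φ / f`, and together they cancel the term `2 φ / f`.
What is left is a degenerate U-statistic of second moment `O(1 / (n h^d) + 1 / n)`, a centered
i.i.d. sum of vanishing variance, and a bias of order `√n h^r + n^(-1/2)`
(`SmoothingModel.tendstoInMeasure_linear`).

In the noise sum `f̂` may be replaced by `f`, because the noise terms are orthogonal given the
design (`SmoothingModel.tendstoInMeasure_noise`). The central limit theorem and the Cramér–Wold
device conclude.

As `f̂` may be close to zero, these estimates concern `max f̂ (b / 2)`. A Chernoff bound and a union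
bound over the sample show that this truncation is inactive with probability tending to one
(`SmoothingModel.tendsto_measureReal_exists_lt`). -/

/-- A crude Taylor bound for a function whose `r`-th derivative is bounded. -/
lemma abs_sub_taylor_le {r : ℕ} {B : ℝ} {F : ℕ → ℝ → ℝ}
    (hF : ∀ k < r, ∀ t, HasDerivAt (F k) (F (k + 1) t) t) (hB : ∀ t, |F r t| ≤ B) :
    ∀ t ∈ Set.Icc (0 : ℝ) 1,
      |F 0 t - ∑ k ∈ Finset.range r, F k 0 * (t ^ k / (k.factorial : ℝ))| ≤ B := by
  induction r generalizing F with
  | zero => intro t _; simpa using hB t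
  | succ r ih =>
    have hB0 : 0 ≤ B := (abs_nonneg _).trans (hB 0)
    have ih' := ih (F := fun k => F (k + 1)) (fun k hk t => hF (k + 1) (by omega) t) hB
    intro t ht
    -- The derivative of this remainder is the remainder of `F 1` of one order less, bounded by
    -- induction. As `R 0 = 0`, the mean value inequality transfers the bound; the factorial gain is
    -- given up.
    set R : ℝ → ℝ := fun t =>
      F 0 t - ∑ k ∈ Finset.range (r + 1), F k 0 * (t ^ k / (k.factorial : ℝ)) with hR
    have hderiv : ∀ s, HasDerivAt R
        (F 1 s - ∑ k ∈ Finset.range r, F (k + 1) 0 * (s ^ k / (k.factorial : ℝ))) s := by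
      intro s
      refine (hF 0 (by omega) s).sub ?_
      have h1 : HasDerivAt (fun t : ℝ => ∑ k ∈ Finset.range (r + 1),
          F k 0 * (t ^ k / (k.factorial : ℝ)))
          (∑ k ∈ Finset.range (r + 1), F k 0 * ((k * s ^ (k - 1)) / (k.factorial : ℝ))) s := by
        refine HasDerivAt.fun_sum fun k _ => ?_
        exact ((hasDerivAt_pow k s).div_const _).const_mul _
      refine h1.congr_deriv ?_
      rw [Finset.sum_range_succ']
      simp only [Nat.cast_zero, zero_mul, zero_div, mul_zero, add_zero]
      refine Finset.sum_congr rfl fun k _ => ?_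
      congr 1
      rw [Nat.factorial_succ]
      have : (k.factorial : ℝ) ≠ 0 := by positivity
      push_cast
      field_simp
    have h0 : R 0 = 0 := by
      simp only [hR]
      rw [Finset.sum_range_succ']
      simp
    have := Convex.norm_image_sub_le_of_norm_deriv_le (f := R) (C := B) (s := Set.Icc 0 1)
      (fun s _ => (hderiv s).differentiableAt)
      (fun s hs => by rw [(hderiv s).deriv]; exact ih' s hs) (convex_Icc 0 1)
      (Set.left_mem_Icc.2 zero_le_one) ht
    rw [h0, sub_zero, sub_zero] at this
    refine this.trans ?_
    rw [Real.norm_eq_abs, abs_of_nonneg ht.1]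
    nlinarith [ht.2]

/-! ### Taylor expansion, kernel moments and smoothing bias -/

section Analysis

variable {d : ℕ}

local notation "𝔼" => EuclideanSpace ℝ (Fin d)

/-- Taylor's formula around `x` for a function with bounded `r`-th derivative. -/
lemma HasBoundedDerivOfOrder.exists_taylor_bound {r : ℕ} {f : 𝔼 → ℝ}
    (hf : HasBoundedDerivOfOrder r f) :
    ∃ M : ℝ, 0 ≤ M ∧ ∀ x v : 𝔼, |f (x + v) - ∑ k ∈ Finset.range r,
      iteratedFDeriv ℝ k f x (fun _ => v) * ((k.factorial : ℝ))⁻¹| ≤ M * ‖v‖ ^ r := by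
  obtain ⟨hd, M, hM⟩ := hf
  refine ⟨M, (norm_nonneg _).trans (hM 0), fun x v => ?_⟩
  -- Restriction to the segment from `x` to `x + v` reduces the claim to one variable.
  have := abs_sub_taylor_le (r := r) (B := M * ‖v‖ ^ r)
    (F := fun k t => iteratedFDeriv ℝ k f (x + t • v) (fun _ => v)) ?_ ?_ 1 (by simp)
  · simpa using this
  · intro k hk t
    have h1 : HasDerivAt (fun t : ℝ => x + t • v) v t := by
      simpa using ((hasDerivAt_id t).smul_const v).const_add x
    have h2 := (hd k hk (x + t • v)).hasFDerivAt.comp_hasDerivAt t h1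
    have h3 := ((ContinuousMultilinearMap.apply ℝ (fun _ : Fin k => 𝔼) ℝ
      (fun _ => v)).hasFDerivAt).comp_hasDerivAt t h2
    exact h3
  · intro t
    have := (iteratedFDeriv ℝ r f (x + t • v)).le_opNorm (fun _ => v)
    simp only [Finset.prod_const, Finset.card_univ, Fintype.card_fin] at this
    exact this.trans (by gcongr; exact hM _)

/-- The smoothing `x ↦ ∫ K v * u (x + h v) dv` of `u`. -/
noncomputable def kernelSmooth (K : 𝔼 → ℝ) (h : ℝ) (u : 𝔼 → ℝ) (x : 𝔼) : ℝ :=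
  ∫ v, K v * u (x + h • v)

lemma IsKernelOfOrder.exists_bound {r : ℕ} {K : 𝔼 → ℝ} (hK : IsKernelOfOrder r K) :
    ∃ C : ℝ, 0 ≤ C ∧ ∀ u, |K u| ≤ C := by
  obtain ⟨C₁, C₂, hC₂, hb⟩ := hK.exp_bound
  refine ⟨|C₁|, abs_nonneg _, fun u => (hb u).trans ?_⟩
  calc C₁ * Real.exp (-C₂ * ‖u‖) ≤ |C₁| * 1 := by
        gcongr
        · exact le_abs_self _
        · rw [Real.exp_le_one_iff]; nlinarith [norm_nonneg u]
    _ = |C₁| := mul_one _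

/-- Exponential decay beats every power: the exponential series is bounded below by its term of
degree `k + (d + 1)`, where `k` pays for the moment and `d + 1` for integrability on `ℝ^d`. -/
lemma IsKernelOfOrder.integrable_norm_pow_mul {r : ℕ} {K : 𝔼 → ℝ} (hK : IsKernelOfOrder r K)
    (k : ℕ) : Integrable fun v => ‖v‖ ^ k * |K v| := by
  obtain ⟨C₁, C₂, hC₂, hb⟩ := hK.exp_bound
  have hint : Integrable fun v : 𝔼 => (1 + ‖v‖) ^ (-((d + 1 : ℕ) : ℝ)) :=
    integrable_one_add_norm (by simp)
  set m := k + (d + 1) with hm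
  refine (hint.const_mul (|C₁| * (Real.exp C₂ * (m.factorial / C₂ ^ m)))).mono' ?_ ?_
  · exact ((measurable_norm.pow_const k).mul hK.measurable.abs).aestronglyMeasurable
  · refine Eventually.of_forall fun v => ?_
    have h1 : (C₂ * (1 + ‖v‖)) ^ m / m.factorial ≤ Real.exp (C₂ * (1 + ‖v‖)) :=
      Real.pow_div_factorial_le_exp _ (by positivity) _
    have hpos : 0 < 1 + ‖v‖ := by positivity
    have h2 : Real.exp (-C₂ * ‖v‖) ≤ Real.exp C₂ * (m.factorial / C₂ ^ m) / (1 + ‖v‖) ^ m := by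
      have : Real.exp (-C₂ * ‖v‖) = Real.exp C₂ / Real.exp (C₂ * (1 + ‖v‖)) := by
        rw [← Real.exp_sub]; ring_nf
      rw [this, div_le_div_iff₀ (Real.exp_pos _) (by positivity)]
      rw [div_le_iff₀ (by positivity), mul_pow] at h1
      have h3 : (1 + ‖v‖) ^ m ≤ m.factorial / C₂ ^ m * Real.exp (C₂ * (1 + ‖v‖)) := by
        rw [div_mul_eq_mul_div, le_div_iff₀ (by positivity)]
        linarith
      calc _ ≤ Real.exp C₂ * (m.factorial / C₂ ^ m * Real.exp (C₂ * (1 + ‖v‖))) := by gcongr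
        _ = _ := by ring
    rw [Real.norm_of_nonneg (by positivity), Real.rpow_neg hpos.le, Real.rpow_natCast]
    calc ‖v‖ ^ k * |K v|
        ≤ (1 + ‖v‖) ^ k * (|C₁| * (Real.exp C₂ * (m.factorial / C₂ ^ m) / (1 + ‖v‖) ^ m)) := by
          gcongr
          · linarith
          · exact (hb v).trans (mul_le_mul (le_abs_self _) h2 (Real.exp_pos _).le (abs_nonneg _))
      _ = _ := by
          rw [hm, pow_add (1 + ‖v‖) k]
          field_simp

lemma IsKernelOfOrder.integrable {r : ℕ} {K : 𝔼 → ℝ} (hK : IsKernelOfOrder r K) :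
    Integrable K := by
  have := hK.integrable_norm_pow_mul 0
  simp only [pow_zero, one_mul] at this
  exact (integrable_norm_iff hK.measurable.aestronglyMeasurable).1 this

/-- Homogeneous polynomials of degree `1, …, r - 1` integrate to zero against the kernel. -/
lemma IsKernelOfOrder.integral_multilinear_eq_zero {r : ℕ} {K : 𝔼 → ℝ}
    (hK : IsKernelOfOrder r K) {k : ℕ} (hk : 1 ≤ k) (hkr : k < r)
    (T : ContinuousMultilinearMap ℝ (fun _ : Fin k => 𝔼) ℝ) :
    ∫ v, T (fun _ => v) * K v = 0 := by
  classical
  let ε : Fin d → 𝔼 := fun i => EuclideanSpace.basisFun (Fin d) ℝ i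
  -- Expanding in the standard basis turns `T (v, …, v)` into monomials indexed by maps `s`.
  -- Coordinate `i` has as exponent the size of the fiber of `s` over `i`, so the exponents add up
  -- to `k` and the moment condition applies.
  have hexp : ∀ v : 𝔼, T (fun _ => v)
      = ∑ s : Fin k → Fin d, (∏ j, v (s j)) * T (fun j => ε (s j)) := by
    intro v
    have hv : v = ∑ i, v i • ε i := by
      simpa [ε] using ((EuclideanSpace.basisFun (Fin d) ℝ).sum_repr v).symm
    calc T (fun _ => v) = T (fun _ => ∑ i, v i • ε i) := by rw [← hv]
      _ = ∑ s : Fin k → Fin d, T (fun j => v (s j) • ε (s j)) :=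
          T.map_sum (fun _ i => v i • ε i)
      _ = _ := by
          refine Finset.sum_congr rfl fun s _ => ?_
          rw [T.map_smul_univ (fun j => v (s j)) (fun j => ε (s j)), smul_eq_mul]
  have hmon : ∀ s : Fin k → Fin d, ∀ v : 𝔼,
      ∏ j, v (s j) = ∏ i, v i ^ (Finset.univ.filter fun j => s j = i).card := by
    intro s v
    rw [← Finset.prod_fiberwise (s := Finset.univ) (g := s) (f := fun j => v (s j))]
    refine Finset.prod_congr rfl fun i _ => ?_
    rw [Finset.prod_congr rfl (g := fun _ => v i)
      (fun j hj => by rw [(Finset.mem_filter.1 hj).2]), Finset.prod_const]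
  have hdeg : ∀ s : Fin k → Fin d, ∑ i, (Finset.univ.filter fun j => s j = i).card = k := by
    intro s
    rw [← Finset.card_eq_sum_card_fiberwise (f := s) (s := Finset.univ) (t := Finset.univ)
      (by simp)]
    simp
  simp_rw [hexp, Finset.sum_mul]
  rw [integral_finsetSum]
  · refine Finset.sum_eq_zero fun s _ => ?_
    have h0 := hK.moment_eq_zero (fun i => (Finset.univ.filter fun j => s j = i).card)
      (by rw [hdeg]; exact hk) (by rw [hdeg]; exact hkr)
    simp_rw [hmon s]
    have : ∀ v : 𝔼, (∏ i, v i ^ (Finset.univ.filter fun j => s j = i).card)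
        * T (fun j => ε (s j)) * K v
        = T (fun j => ε (s j)) * ((∏ i, v i ^ (Finset.univ.filter fun j => s j = i).card) * K v) :=
      fun v => by ring
    simp_rw [this]
    rw [integral_const_mul, h0, mul_zero]
  · intro s _
    refine ((hK.integrable_norm_pow_mul k).const_mul |T (fun j => ε (s j))|).mono' ?_ ?_
    · exact (((Finset.measurable_prod _ fun j _ => by fun_prop).mul_const _).mul
        hK.measurable).aestronglyMeasurable
    · refine Eventually.of_forall fun v => ?_
      rw [norm_mul, norm_mul, norm_prod, mul_comm (∏ j, _) _, mul_assoc]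
      gcongr
      · simp
      · calc ∏ j, ‖v (s j)‖ ≤ ∏ _j : Fin k, ‖v‖ :=
            Finset.prod_le_prod (fun _ _ => norm_nonneg _) fun j _ => PiLp.norm_apply_le v (s j)
          _ = ‖v‖ ^ k := by simp
      · simp

lemma IsKernelOfOrder.abs_kernelSmooth_le {r : ℕ} {K : 𝔼 → ℝ} (hK : IsKernelOfOrder r K)
    {u : 𝔼 → ℝ} {B : ℝ} (hB : ∀ x, |u x| ≤ B) (h : ℝ) (x : 𝔼) :
    |kernelSmooth K h u x| ≤ (∫ v, |K v|) * B := by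
  have h0 : (∫ v, |K v|) * B = ∫ v, |K v| * B := (integral_mul_const B _).symm
  rw [h0, kernelSmooth, ← Real.norm_eq_abs]
  refine norm_integral_le_of_norm_le (hK.integrable.abs.mul_const B)
    (Eventually.of_forall fun v => ?_)
  rw [norm_mul]
  exact mul_le_mul_of_nonneg_left (hB _) (norm_nonneg _)

/-- The bias of the kernel smoother is of the order `h ^ r`. -/
lemma IsKernelOfOrder.exists_bias_bound {r : ℕ} {K : 𝔼 → ℝ} (hK : IsKernelOfOrder r K)
    (hr : 1 ≤ r) {f : 𝔼 → ℝ} (hf : HasBoundedDerivOfOrder r f) (hfm : Measurable f)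
    {M : ℝ} (hM : ∀ x, |f x| ≤ M) :
    ∃ B : ℝ, 0 ≤ B ∧ ∀ h, 0 < h → ∀ x, |kernelSmooth K h f x - f x| ≤ B * h ^ r := by
  obtain ⟨A, hA0, hA⟩ := hf.exists_taylor_bound
  refine ⟨A * ∫ v, ‖v‖ ^ r * |K v|,
    mul_nonneg hA0 (integral_nonneg fun v => by positivity), fun h hh x => ?_⟩
  -- From here on the order is `r + 1`, so that the constant Taylor term can be split off.
  obtain ⟨r, rfl⟩ : ∃ s, r = s + 1 := ⟨r - 1, by omega⟩
  have hint : ∀ k, Integrable fun v : 𝔼 =>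
      K v * (iteratedFDeriv ℝ k f x (fun _ => h • v) * ((k.factorial : ℝ))⁻¹) := by
    intro k
    refine ((hK.integrable_norm_pow_mul k).const_mul
      (‖iteratedFDeriv ℝ k f x‖ * |h| ^ k * ((k.factorial : ℝ))⁻¹)).mono' ?_ ?_
    · refine (hK.measurable.mul (Measurable.mul_const ?_ _)).aestronglyMeasurable
      exact ((iteratedFDeriv ℝ k f x).cont.comp
        (continuous_pi fun _ => continuous_const_smul h)).measurable
    · refine Eventually.of_forall fun v => ?_
      have := (iteratedFDeriv ℝ k f x).le_opNorm (fun _ => h • v)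
      simp only [Finset.prod_const, Finset.card_univ, Fintype.card_fin, norm_smul, mul_pow,
        Real.norm_eq_abs] at this
      rw [norm_mul, norm_mul, Real.norm_eq_abs, Real.norm_eq_abs, norm_inv, Real.norm_natCast]
      calc _ ≤ |K v| * (‖iteratedFDeriv ℝ k f x‖ * (|h| ^ k * ‖v‖ ^ k)
            * ((k.factorial : ℝ))⁻¹) := by gcongr
        _ = _ := by ring
  have hmain : Integrable fun v => K v * f (x + h • v) :=
    hK.integrable.mul_bdd (c := M) (hfm.comp (by fun_prop)).aestronglyMeasurable
      (Eventually.of_forall fun v => hM _)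
  -- Against the kernel the Taylor polynomial integrates to its constant term, so the bias is the
  -- integrated Taylor remainder.
  have hpoly : ∫ v, ∑ k ∈ Finset.range (r + 1),
      K v * (iteratedFDeriv ℝ k f x (fun _ => h • v) * ((k.factorial : ℝ))⁻¹) = f x := by
    rw [integral_finsetSum _ fun k _ => hint k, Finset.sum_range_succ']
    rw [Finset.sum_eq_zero, zero_add]
    · simp [iteratedFDeriv_zero_apply, integral_mul_const, hK.integral_eq_one]
    · intro k hk
      have h0 := hK.integral_multilinear_eq_zero (k := k + 1) (by omega)
        (by have := Finset.mem_range.1 hk; omega) (iteratedFDeriv ℝ (k + 1) f x)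
      have : ∀ v : 𝔼, K v * (iteratedFDeriv ℝ (k + 1) f x (fun _ => h • v)
          * (((k + 1).factorial : ℝ))⁻¹)
          = (h ^ (k + 1) * (((k + 1).factorial : ℝ))⁻¹)
            * (iteratedFDeriv ℝ (k + 1) f x (fun _ => v) * K v) := by
        intro v
        rw [(iteratedFDeriv ℝ (k + 1) f x).map_smul_univ (fun _ => h) (fun _ => v)]
        simp only [Finset.prod_const, Finset.card_univ, Fintype.card_fin, smul_eq_mul]
        ring
      simp_rw [this]
      rw [integral_const_mul, h0, mul_zero]
  unfold kernelSmooth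
  nth_rewrite 1 [← hpoly]
  rw [← integral_sub hmain (integrable_finsetSum _ fun k _ => hint k)]
  have hb : ∀ v : 𝔼, ‖K v * f (x + h • v) - ∑ k ∈ Finset.range (r + 1),
      K v * (iteratedFDeriv ℝ k f x (fun _ => h • v) * ((k.factorial : ℝ))⁻¹)‖
      ≤ (A * h ^ (r + 1)) * (‖v‖ ^ (r + 1) * |K v|) := by
    intro v
    rw [← Finset.mul_sum, ← mul_sub, norm_mul, Real.norm_eq_abs, Real.norm_eq_abs]
    have := hA x (h • v)
    rw [norm_smul, Real.norm_eq_abs, abs_of_pos hh, mul_pow] at this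
    calc _ ≤ |K v| * (A * (h ^ (r + 1) * ‖v‖ ^ (r + 1))) := by gcongr
      _ = _ := by ring
  refine (norm_integral_le_of_norm_le ((hK.integrable_norm_pow_mul (r + 1)).const_mul _)
    (Eventually.of_forall hb)).trans_eq ?_
  rw [integral_const_mul]
  ring

lemma integral_comp_inv_smul_sub (F : 𝔼 → ℝ) {h : ℝ} (hh : 0 < h) (x : 𝔼) :
    ∫ y, F (h⁻¹ • (y - x)) = h ^ d * ∫ v, F v := by
  rw [integral_sub_right_eq_self (fun y => F (h⁻¹ • y)) x,
    Measure.integral_comp_inv_smul volume F h]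
  simp [abs_of_pos hh]

/-- Change of variables `y = x + h v` in an integral against a scaled kernel. -/
lemma integral_scaled_kernel_mul (K u : 𝔼 → ℝ) {h : ℝ} (hh : 0 < h) (x : 𝔼) :
    ∫ y, K (h⁻¹ • (y - x)) * u y = h ^ d * kernelSmooth K h u x := by
  rw [kernelSmooth, ← integral_comp_inv_smul_sub (fun v => K v * u (x + h • v)) hh x]
  congr with y
  rw [smul_inv_smul₀ hh.ne', add_sub_cancel]

/-- Dominated convergence with majorant `|K| B`, since `u x` is itself the integral of `K v * u x`.
No rate is obtained; the variance argument that uses it needs none. -/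
lemma kernelSmooth_tendsto {r : ℕ} {K : 𝔼 → ℝ} (hK : IsKernelOfOrder r K)
    {u : 𝔼 → ℝ} (hum : Measurable u) {B : ℝ} (hB : ∀ x, |u x| ≤ B) {x : 𝔼}
    (hx : ContinuousAt u x) {h : ℕ → ℝ} (hh : Tendsto h atTop (𝓝 0)) :
    Tendsto (fun n => kernelSmooth K (h n) u x) atTop (𝓝 (u x)) := by
  have : u x = ∫ v, K v * u x := by rw [integral_mul_const, hK.integral_eq_one, one_mul]
  rw [this]
  refine tendsto_integral_of_dominated_convergence (fun v => |K v| * B) ?_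
    (hK.integrable.abs.mul_const B) ?_ ?_
  · intro n
    exact (hK.measurable.mul (hum.comp (by fun_prop))).aestronglyMeasurable
  · intro n
    refine Eventually.of_forall fun v => ?_
    rw [norm_mul]
    exact mul_le_mul_of_nonneg_left (hB _) (norm_nonneg _)
  · refine Eventually.of_forall fun v => Tendsto.const_mul _ ?_
    have h1 : Tendsto (fun n => x + h n • v) atTop (𝓝 x) := by
      simpa using (hh.smul_const v).const_add x
    exact hx.tendsto.comp h1

lemma measurable_kernelSmooth {K u : 𝔼 → ℝ} (hK : Measurable K) (hu : Measurable u) (h : ℝ) :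
    Measurable (kernelSmooth K h u) := by
  unfold kernelSmooth
  refine (StronglyMeasurable.integral_prod_right (f := fun x v => K v * u (x + h • v))
    (ν := volume) ?_).measurable
  refine Measurable.stronglyMeasurable ?_
  exact (hK.comp measurable_snd).mul (hu.comp (by fun_prop))

/-- Smoothing converges in mean square at a function which is continuous almost everywhere. -/
lemma tendsto_integral_sub_kernelSmooth_sq {r : ℕ} {K : 𝔼 → ℝ} (hK : IsKernelOfOrder r K)
    {μ : Measure 𝔼} [IsFiniteMeasure μ]
    {u : 𝔼 → ℝ} (hum : Measurable u) {B : ℝ} (hB : ∀ x, |u x| ≤ B)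
    (hcont : ∀ᵐ x ∂μ, ContinuousAt u x) {h : ℕ → ℝ} (hh : Tendsto h atTop (𝓝 0)) :
    Tendsto (fun n => ∫ x, (u x - kernelSmooth K (h n) u x) ^ 2 ∂μ) atTop (𝓝 0) := by
  have : (0 : ℝ) = ∫ x, (0 : ℝ) ∂μ := by simp
  rw [this]
  refine tendsto_integral_of_dominated_convergence
    (fun _ => (B + (∫ v, |K v|) * B) ^ 2) ?_ (integrable_const _) ?_ ?_
  · intro n
    exact ((hum.sub (measurable_kernelSmooth hK.measurable hum _)).pow_const 2).aestronglyMeasurable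
  · intro n
    refine Eventually.of_forall fun x => ?_
    rw [norm_pow, Real.norm_eq_abs]
    gcongr
    exact (abs_sub _ _).trans (add_le_add (hB x) (hK.abs_kernelSmooth_le hB _ x))
  · filter_upwards [hcont] with x hx
    have := (kernelSmooth_tendsto hK hum hB hx hh).const_sub (u x)
    simpa using this.pow 2

end Analysis

/-! ### Second moments, a Chernoff bound and convergence in probability -/

section Probability

set_option linter.unusedSectionVars false

variable {Ω : Type*} [MeasurableSpace Ω] {P : Measure Ω} [IsProbabilityMeasure P]

lemma integrable_of_abs_le {Z : Ω → ℝ} (hZ : AEMeasurable Z P) {B : ℝ} (hB : ∀ ω, |Z ω| ≤ B) :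
    Integrable Z P :=
  Integrable.of_bound hZ.aestronglyMeasurable B (Eventually.of_forall hB)

lemma memLp_of_abs_le {Z : Ω → ℝ} (hZ : AEMeasurable Z P) {B : ℝ} (hB : ∀ ω, |Z ω| ≤ B) :
    MemLp Z 2 P :=
  MemLp.of_bound hZ.aestronglyMeasurable B (Eventually.of_forall hB)

/-- If the conditional means given the first argument vanish, so does the mean. -/
lemma ProbabilityTheory.IndepFun.integral_eq_zero_of_forall {α β : Type*} [MeasurableSpace α]
    [MeasurableSpace β] {V : Ω → α} {W : Ω → β} (hVW : IndepFun V W P) (hV : Measurable V)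
    (hW : Measurable W) {F : α × β → ℝ} (hF : Measurable F)
    (h0 : ∀ v, ∫ ω, F (v, W ω) ∂P = 0) : ∫ ω, F (V ω, W ω) ∂P = 0 := by
  -- Without integrability the integral is zero by convention, so the conclusion needs no
  -- integrability assumption.
  by_cases hint : Integrable (fun ω => F (V ω, W ω)) P
  · have hlaw := hVW.map_prod_eq_prod_map_map hV.aemeasurable hW.aemeasurable
    have hVWm : Measurable fun ω => (V ω, W ω) := hV.prodMk hW
    rw [← integral_map (φ := fun ω => (V ω, W ω)) hVWm.aemeasurable hF.aestronglyMeasurable]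
    have hint' := (integrable_map_measure (f := fun ω => (V ω, W ω)) (μ := P) (g := F)
      hF.aestronglyMeasurable hVWm.aemeasurable).2 hint
    rw [hlaw] at hint' ⊢
    rw [integral_prod _ hint']
    have : ∀ v, ∫ w, F (v, w) ∂(P.map W) = 0 := by
      intro v
      rw [integral_map hW.aemeasurable (f := fun w => F (v, w))
        (hF.comp measurable_prodMk_left).aestronglyMeasurable]
      exact h0 v
    simp [this]
  · exact integral_undef hint

lemma ProbabilityTheory.IndepFun.integral_le_of_forall {α β : Type*} [MeasurableSpace α]
    [MeasurableSpace β] {V : Ω → α} {W : Ω → β} (hVW : IndepFun V W P) (hV : Measurable V)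
    (hW : Measurable W) {F : α × β → ℝ} (hF : Measurable F)
    (hint : Integrable (fun ω => F (V ω, W ω)) P) {c : ℝ}
    (hc : ∀ v, ∫ ω, F (v, W ω) ∂P ≤ c) : ∫ ω, F (V ω, W ω) ∂P ≤ c := by
  have hlaw := hVW.map_prod_eq_prod_map_map hV.aemeasurable hW.aemeasurable
  have hVWm : Measurable fun ω => (V ω, W ω) := hV.prodMk hW
  rw [← integral_map (φ := fun ω => (V ω, W ω)) hVWm.aemeasurable hF.aestronglyMeasurable]
  have hint' := (integrable_map_measure (f := fun ω => (V ω, W ω)) (μ := P) (g := F)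
    hF.aestronglyMeasurable hVWm.aemeasurable).2 hint
  have := Measure.isProbabilityMeasure_map (μ := P) hV.aemeasurable
  rw [hlaw] at hint' ⊢
  rw [integral_prod _ hint']
  calc _ ≤ ∫ _v, c ∂(P.map V) := by
        refine integral_mono hint'.integral_prod_left (integrable_const _) fun v => ?_
        rw [integral_map hW.aemeasurable (f := fun w => F (v, w))
        (hF.comp measurable_prodMk_left).aestronglyMeasurable]
        exact hc v
    _ = c := by simp

/-- Second moment of a sum with few correlated pairs. -/
lemma integral_sum_sq_le {ι : Type*} [DecidableEq ι] (s : Finset ι) {Z : ι → Ω → ℝ}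
    (hZ : ∀ p ∈ s, MemLp (Z p) 2 P) {c : ℝ} (hc : ∀ p ∈ s, ∫ ω, Z p ω ^ 2 ∂P ≤ c)
    {κ : ℕ} (N : ι → Finset ι) (hN : ∀ p ∈ s, (N p).card ≤ κ)
    (h0 : ∀ p ∈ s, ∀ q ∈ s, q ∉ N p → ∫ ω, Z p ω * Z q ω ∂P = 0) :
    ∫ ω, (∑ p ∈ s, Z p ω) ^ 2 ∂P ≤ s.card * (κ * c) := by
  have hint : ∀ p ∈ s, ∀ q ∈ s, Integrable (fun ω => Z p ω * Z q ω) P :=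
    fun p hp q hq => (hZ p hp).integrable_mul (hZ q hq)
  -- The inequality `2ab ≤ a² + b²` bounds every mixed moment by `c`; at most `κ` of them survive
  -- for each `p`.
  have hpq : ∀ p ∈ s, ∀ q ∈ s, ∫ ω, Z p ω * Z q ω ∂P ≤ c := by
    intro p hp q hq
    have hp2 := (hZ p hp).integrable_sq
    have hq2 := (hZ q hq).integrable_sq
    calc ∫ ω, Z p ω * Z q ω ∂P ≤ ∫ ω, (Z p ω ^ 2 / 2 + Z q ω ^ 2 / 2) ∂P :=
          integral_mono (hint p hp q hq) ((hp2.div_const 2).add (hq2.div_const 2))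
            fun ω => by dsimp only; nlinarith [sq_nonneg (Z p ω - Z q ω)]
      _ ≤ c := by
          rw [integral_add (hp2.div_const 2) (hq2.div_const 2), integral_div, integral_div]
          linarith [hc p hp, hc q hq]
  have hexp : ∀ ω, (∑ p ∈ s, Z p ω) ^ 2 = ∑ p ∈ s, ∑ q ∈ s, Z p ω * Z q ω := by
    intro ω; rw [sq, Finset.sum_mul_sum]
  simp_rw [hexp]
  rw [integral_finsetSum _ fun p hp => integrable_finsetSum _ fun q hq => hint p hp q hq]
  rw [← nsmul_eq_mul]
  refine Finset.sum_le_card_nsmul _ _ _ fun p hp => ?_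
  rw [integral_finsetSum _ fun q hq => hint p hp q hq]
  have hc0 : 0 ≤ c := (integral_nonneg fun ω => sq_nonneg (Z p ω)).trans (hc p hp)
  rw [← Finset.sum_filter_of_ne (p := fun q => q ∈ N p)
    (fun q hq hne => by by_contra hqN; exact hne (h0 p hp q hq hqN))]
  refine (Finset.sum_le_card_nsmul _ _ c fun q hq =>
    hpq p hp q (Finset.mem_filter.1 hq).1).trans ?_
  rw [nsmul_eq_mul]
  gcongr
  refine le_trans (Finset.card_le_card fun q hq => ?_) (hN p hp)
  exact (Finset.mem_filter.1 hq).2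

variable {E : Type*} [MeasurableSpace E] {X : ℕ → Ω → E} {μ : Measure E}

/-- A product of two kernel terms carries four indices. When one of them, `t`, differs from the
others, this allows integrating over `X t` with the rest frozen; the other three may coincide. -/
lemma ProbabilityTheory.iIndepFun.indepFun_triple (hX : iIndepFun X P)
    (hXm : ∀ i, Measurable (X i)) {i k l t : ℕ} (hi : i ≠ t) (hk : k ≠ t) (hl : l ≠ t) :
    IndepFun (fun ω => (X i ω, X k ω, X l ω)) (X t) P := by
  have := hX.indepFun_finset {i, k, l} {t} (by simp [hi.symm, hk.symm, hl.symm]) hXm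
  exact this.comp
    (φ := fun w : ({i, k, l} : Finset ℕ) → E => (w ⟨i, by simp⟩, w ⟨k, by simp⟩, w ⟨l, by simp⟩))
    (ψ := fun w : ({t} : Finset ℕ) → E => w ⟨t, by simp⟩) (by fun_prop) (by fun_prop)

/-- Second moment of a completely degenerate U-statistic of order two. -/
lemma integral_degenerate_sum_sq_le (hX : iIndepFun X P) (hXm : ∀ i, Measurable (X i))
    (hlaw : ∀ i, HasLaw (X i) μ P) {ζ : E → E → ℝ} (hζ : Measurable (Function.uncurry ζ))
    {B : ℝ} (hB : ∀ x y, |ζ x y| ≤ B) (h1 : ∀ x, ∫ y, ζ x y ∂μ = 0)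
    (h2 : ∀ y, ∫ x, ζ x y ∂μ = 0) {s : ℝ} (hs : ∀ x, ∫ y, ζ x y ^ 2 ∂μ ≤ s) (n : ℕ) :
    ∫ ω, (∑ p ∈ (Finset.range n).offDiag, ζ (X p.1 ω) (X p.2 ω)) ^ 2 ∂P
      ≤ (Finset.range n).offDiag.card * (2 * s) := by
  have hm : ∀ i j, Measurable fun ω => ζ (X i ω) (X j ω) :=
    fun i j => hζ.comp ((hXm i).prodMk (hXm j))
  have hmr : ∀ x, Measurable (ζ x) := fun x => hζ.comp measurable_prodMk_left
  have hml : ∀ y, Measurable fun x => ζ x y := fun y => hζ.comp measurable_prodMk_right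
  have hzr : ∀ x j, ∫ ω, ζ x (X j ω) ∂P = 0 := fun x j => by
    rw [← h1 x, ← (hlaw j).integral_comp (hmr x).aestronglyMeasurable]; rfl
  have hzl : ∀ y j, ∫ ω, ζ (X j ω) y ∂P = 0 := fun y j => by
    rw [← h2 y, ← (hlaw j).integral_comp (hml y).aestronglyMeasurable]; rfl
  -- The index `j` occurs only once, and integrating over `X j` alone already gives zero by
  -- degeneracy. `key'` does the same for the first slot.
  have key : ∀ i j k l, i ≠ j → j ≠ k → j ≠ l →
      ∫ ω, ζ (X i ω) (X j ω) * ζ (X k ω) (X l ω) ∂P = 0 := by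
    intro i j k l hij hjk hjl
    refine (hX.indepFun_triple hXm hij hjk.symm hjl.symm).integral_eq_zero_of_forall
      ((hXm i).prodMk ((hXm k).prodMk (hXm l))) (hXm j)
      (F := fun v => ζ v.1.1 v.2 * ζ v.1.2.1 v.1.2.2) ?_ ?_
    · exact (hζ.comp (by fun_prop : Measurable fun v : (E × E × E) × E => (v.1.1, v.2))).mul
        (hζ.comp (by fun_prop : Measurable fun v : (E × E × E) × E => (v.1.2.1, v.1.2.2)))
    · intro v
      dsimp only
      rw [integral_mul_const, hzr, zero_mul]
  have key' : ∀ i j k l, j ≠ i → i ≠ k → i ≠ l →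
      ∫ ω, ζ (X i ω) (X j ω) * ζ (X k ω) (X l ω) ∂P = 0 := by
    intro i j k l hij hik hil
    refine (hX.indepFun_triple hXm hij hik.symm hil.symm).integral_eq_zero_of_forall
      ((hXm j).prodMk ((hXm k).prodMk (hXm l))) (hXm i)
      (F := fun v => ζ v.2 v.1.1 * ζ v.1.2.1 v.1.2.2) ?_ ?_
    · exact (hζ.comp (by fun_prop : Measurable fun v : (E × E × E) × E => (v.2, v.1.1))).mul
        (hζ.comp (by fun_prop : Measurable fun v : (E × E × E) × E => (v.1.2.1, v.1.2.2)))
    · intro v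
      dsimp only
      rw [integral_mul_const, hzl, zero_mul]
  have hsq : ∀ i j, i ≠ j → ∫ ω, ζ (X i ω) (X j ω) ^ 2 ∂P ≤ s := by
    intro i j hij
    refine (hX.indepFun hij).integral_le_of_forall (hXm i) (hXm j)
      (F := fun v => ζ v.1 v.2 ^ 2) (hζ.pow_const 2)
      ((memLp_of_abs_le (hm i j).aemeasurable fun ω => hB _ _).integrable_sq) fun x => ?_
    refine le_trans (le_of_eq ?_) (hs x)
    rw [← (hlaw j).integral_comp ((hmr x).pow_const 2).aestronglyMeasurable]; rfl
  -- If two pairs of distinct indices are not equal up to a swap, some index of the first is absent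
  -- from the second. Hence each pair correlates only with itself and its swap, which gives the
  -- factor 2.
  refine integral_sum_sq_le _ (fun p _ => memLp_of_abs_le (hm _ _).aemeasurable fun ω => hB _ _)
    (fun p hp => hsq _ _ (Finset.mem_offDiag.1 hp).2.2) (fun p => {p, p.swap})
    (fun p _ => Finset.card_le_two) ?_
  rintro ⟨i, j⟩ hp ⟨k, l⟩ hq hN
  have hij := (Finset.mem_offDiag.1 hp).2.2
  have hkl := (Finset.mem_offDiag.1 hq).2.2
  simp only [Finset.mem_insert, Prod.swap_prod_mk, Finset.mem_singleton, not_or,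
    Prod.mk.injEq] at hN hij hkl ⊢
  by_cases hj : j ≠ k ∧ j ≠ l
  · exact key i j k l hij hj.1 hj.2
  · refine key' i j k l hij.symm ?_ ?_ <;> grind

/-- Second moment of a sum of conditionally centered terms. -/
lemma integral_sum_erase_sq_le (hX : iIndepFun X P) (hXm : ∀ i, Measurable (X i))
    (hlaw : ∀ i, HasLaw (X i) μ P) {ζ : E → E → ℝ} (hζ : Measurable (Function.uncurry ζ))
    {B : ℝ} (hB : ∀ x y, |ζ x y| ≤ B) (h1 : ∀ x, ∫ y, ζ x y ∂μ = 0)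
    {s : ℝ} (hs : ∀ x, ∫ y, ζ x y ^ 2 ∂μ ≤ s) (i : ℕ) {S : Finset ℕ} (hi : i ∉ S) :
    ∫ ω, (∑ j ∈ S, ζ (X i ω) (X j ω)) ^ 2 ∂P ≤ S.card * s := by
  have hm : ∀ i j, Measurable fun ω => ζ (X i ω) (X j ω) :=
    fun i j => hζ.comp ((hXm i).prodMk (hXm j))
  have hmr : ∀ x, Measurable (ζ x) := fun x => hζ.comp measurable_prodMk_left
  have hij : ∀ j ∈ S, i ≠ j := fun j hj h => hi (h ▸ hj)
  have := integral_sum_sq_le (P := P) S (Z := fun j ω => ζ (X i ω) (X j ω)) (c := s) (κ := 1)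
    (fun p _ => memLp_of_abs_le (hm _ _).aemeasurable fun ω => hB _ _) ?_ (fun j => {j})
    (fun _ _ => by simp) ?_
  · simpa using this
  · intro j hj
    refine (hX.indepFun (hij j hj)).integral_le_of_forall (hXm i) (hXm j)
      (F := fun v => ζ v.1 v.2 ^ 2) (hζ.pow_const 2)
      ((memLp_of_abs_le (hm i j).aemeasurable fun ω => hB _ _).integrable_sq) fun x => ?_
    refine le_trans (le_of_eq ?_) (hs x)
    rw [← (hlaw j).integral_comp ((hmr x).pow_const 2).aestronglyMeasurable]; rfl
  · intro j hj k hk hjk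
    have hjk : k ≠ j := by simpa using hjk
    refine (hX.indepFun_triple hXm (hij j hj) (hij j hj) hjk).integral_eq_zero_of_forall
      ((hXm i).prodMk ((hXm i).prodMk (hXm k))) (hXm j)
      (F := fun v => ζ v.1.1 v.2 * ζ v.1.2.1 v.1.2.2) ?_ ?_
    · exact (hζ.comp (by fun_prop : Measurable fun v : (E × E × E) × E => (v.1.1, v.2))).mul
        (hζ.comp (by fun_prop : Measurable fun v : (E × E × E) × E => (v.1.2.1, v.1.2.2)))
    · intro v
      have : ∫ ω, ζ v.1 (X j ω) ∂P = 0 := by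
        rw [← h1 v.1, ← (hlaw j).integral_comp (hmr v.1).aestronglyMeasurable]; rfl
      dsimp only
      rw [integral_mul_const, this, zero_mul]

/-- Second moment of a centered sum of independent identically distributed variables. -/
lemma integral_sum_range_sq_le (hX : iIndepFun X P) (hXm : ∀ i, Measurable (X i))
    (hlaw : ∀ i, HasLaw (X i) μ P) {ρ : E → ℝ} (hρ : Measurable ρ)
    {B : ℝ} (hB : ∀ x, |ρ x| ≤ B) (h0 : ∫ x, ρ x ∂μ = 0) (n : ℕ) :
    ∫ ω, (∑ i ∈ Finset.range n, ρ (X i ω)) ^ 2 ∂P ≤ n * ∫ x, ρ x ^ 2 ∂μ := by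
  -- The first argument of the kernel is a dummy, and `n` serves as an index outside the range.
  have := integral_sum_erase_sq_le hX hXm hlaw (ζ := fun _ y => ρ y) (hρ.comp measurable_snd)
    (fun _ => hB) (fun _ => h0) (fun _ => le_rfl) n (S := Finset.range n) (by simp)
  simpa using this

/-- Chernoff bound, conditionally on one of the variables. -/
lemma measureReal_sum_erase_ge_le (hX : iIndepFun X P) (hXm : ∀ i, Measurable (X i))
    (hlaw : ∀ i, HasLaw (X i) μ P) {ζ : E → E → ℝ} (hζ : Measurable (Function.uncurry ζ))
    {B : ℝ} (hB : ∀ x y, |ζ x y| ≤ B) (h1 : ∀ x, ∫ y, ζ x y ∂μ = 0)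
    {s : ℝ} (hs : ∀ x, ∫ y, ζ x y ^ 2 ∂μ ≤ s) {l : ℝ} (hl : 0 ≤ l) (hlB : l * B ≤ 1)
    (i : ℕ) {S : Finset ℕ} (hi : i ∉ S) (t : ℝ) :
    P.real {ω | t ≤ ∑ j ∈ S, ζ (X i ω) (X j ω)} ≤ Real.exp (S.card * (l ^ 2 * s) - l * t) := by
  have := (hlaw 0).isProbabilityMeasure_iff.1 inferInstance
  have hm : ∀ i j, Measurable fun ω => ζ (X i ω) (X j ω) :=
    fun i j => hζ.comp ((hXm i).prodMk (hXm j))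
  have hmr : ∀ x, Measurable (ζ x) := fun x => hζ.comp measurable_prodMk_left
  have hmgf : ∀ x j, mgf (fun ω => ζ x (X j ω)) P l ≤ Real.exp (l ^ 2 * s) := by
    intro x j
    have e1 : mgf (fun ω => ζ x (X j ω)) P l = ∫ y, Real.exp (l * ζ x y) ∂μ := by
      rw [mgf, ← (hlaw j).integral_comp
        (((hmr x).const_mul l).exp).aestronglyMeasurable]; rfl
    have i1 : Integrable (fun y => ζ x y) μ := integrable_of_abs_le (hmr x).aemeasurable (hB x)
    have i2 : Integrable (fun y => ζ x y ^ 2) μ :=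
      (memLp_of_abs_le (hmr x).aemeasurable (hB x)).integrable_sq
    rw [e1]
    -- `exp z ≤ 1 + z + z²` holds for `|z| ≤ 1`, which is the role of `l * B ≤ 1`. Centering removes
    -- the linear term.
    calc ∫ y, Real.exp (l * ζ x y) ∂μ ≤ ∫ y, (1 + l * ζ x y + l ^ 2 * ζ x y ^ 2) ∂μ := by
          refine integral_mono_of_nonneg (Eventually.of_forall fun y => (Real.exp_pos _).le)
            (((integrable_const _).add (i1.const_mul _)).add (i2.const_mul _))
            (Eventually.of_forall fun y => ?_)
          have : |l * ζ x y| ≤ 1 := by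
            rw [abs_mul, abs_of_nonneg hl]
            exact (mul_le_mul_of_nonneg_left (hB x y) hl).trans hlB
          have := (abs_le.1 (Real.abs_exp_sub_one_sub_id_le this)).2
          dsimp only
          nlinarith
      _ = 1 + l ^ 2 * ∫ y, ζ x y ^ 2 ∂μ := by
          have i3 : Integrable (fun y => 1 + l * ζ x y) μ :=
            (integrable_const _).add (i1.const_mul _)
          rw [integral_add i3 (i2.const_mul _),
            integral_add (integrable_const _) (i1.const_mul _), integral_const_mul,
            integral_const_mul, h1 x]
          simp
      _ ≤ 1 + l ^ 2 * s := by gcongr; exact hs x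
      _ ≤ Real.exp (l ^ 2 * s) := by linarith [Real.add_one_le_exp (l ^ 2 * s)]
  have hint : Integrable (fun ω => Real.exp (l * ∑ j ∈ S, ζ (X i ω) (X j ω))) P := by
    refine integrable_of_abs_le (B := Real.exp (S.card * (l * B)))
        ((Measurable.const_mul (Finset.measurable_sum _ fun j _ => hm i j) l).exp).aemeasurable
        fun ω => ?_
    rw [abs_of_pos (Real.exp_pos _), Real.exp_le_exp, Finset.mul_sum]
    refine (Finset.sum_le_card_nsmul _ _ (l * B) fun j _ =>
      mul_le_mul_of_nonneg_left ((le_abs_self _).trans (hB _ _)) hl).trans ?_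
    simp
  have hexp : ∫ ω, Real.exp (l * ∑ j ∈ S, ζ (X i ω) (X j ω)) ∂P
      ≤ Real.exp (S.card * (l ^ 2 * s)) := by
    -- Since `i ∉ S`, the value of `X i` can be frozen; the remaining sum has independent terms and
    -- its exponential moment factorizes.
    have hind : IndepFun (X i) (fun ω (j : S) => X j ω) P := by
      have := hX.indepFun_finset {i} S (by simpa using hi) hXm
      exact this.comp (φ := fun w : ({i} : Finset ℕ) → E => w ⟨i, by simp⟩) (ψ := id) (by fun_prop) measurable_id
    have := hind.integral_le_of_forall (hXm i) (by fun_prop)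
      (F := fun v => Real.exp (l * ∑ j : S, ζ v.1 (v.2 j))) ?_ ?_
      (c := Real.exp (S.card * (l ^ 2 * s))) ?_
    · have hsum : ∀ ω, ∑ j : S, ζ (X i ω) (X j ω) = ∑ j ∈ S, ζ (X i ω) (X j ω) :=
        fun ω => Finset.sum_coe_sort S fun j => ζ (X i ω) (X j ω)
      simpa only [hsum] using this
    · refine (Measurable.const_mul (Finset.measurable_sum _ fun j _ => ?_) l).exp
      exact hζ.comp (by fun_prop : Measurable fun v : E × (S → E) => (v.1, v.2 j))
    · have hsum : ∀ ω, ∑ j : S, ζ (X i ω) (X j ω) = ∑ j ∈ S, ζ (X i ω) (X j ω) :=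
        fun ω => Finset.sum_coe_sort S fun j => ζ (X i ω) (X j ω)
      simpa only [hsum] using hint
    · intro x
      have h2 : iIndepFun (fun j ω => ζ x (X j ω)) P :=
        hX.comp (fun _ => ζ x) fun _ => hmr x
      have h3 := h2.mgf_sum (t := l) (fun j => (hmr x).comp (hXm j)) S
      have h4 : ∫ ω, Real.exp (l * ∑ j : S, ζ x (X j ω)) ∂P
          = mgf (∑ j ∈ S, fun ω => ζ x (X j ω)) P l := by
        have hsum : ∀ ω, ∑ j : S, ζ x (X j ω) = ∑ j ∈ S, ζ x (X j ω) :=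
          fun ω => Finset.sum_coe_sort S fun j => ζ x (X j ω)
        simp only [mgf, Finset.sum_apply, hsum]
      dsimp only
      rw [h4, h3, Real.exp_nat_mul, ← Finset.prod_const]
      exact Finset.prod_le_prod (fun j _ => mgf_nonneg) fun j _ => hmgf x j
  have := measure_ge_le_exp_mul_mgf (μ := P) (X := fun ω => ∑ j ∈ S, ζ (X i ω) (X j ω)) t hl hint
  refine this.trans ?_
  rw [sub_eq_neg_add, Real.exp_add, ← neg_mul]
  gcongr
  exact hexp

/-- Second moment of a weighted sum of centered noise variables with weights depending on an
independent process. -/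
lemma integral_noise_sum_sq_le {X : ℕ → Ω → E} {e : ℕ → Ω → ℝ}
    (hXm : ∀ i, Measurable (X i)) (hem : ∀ i, Measurable (e i))
    (he : iIndepFun e P) (hident : ∀ i, IdentDistrib (e i) (e 0) P P)
    (hXe : IndepFun (fun ω i => X i ω) (fun ω i => e i ω) P)
    (he2 : MemLp (e 0) 2 P) (he0 : ∫ ω, e 0 ω ∂P = 0)
    {H : ℕ → (ℕ → E) → ℝ} (hH : ∀ i, Measurable (H i)) {B : ℝ} (hB : ∀ i x, |H i x| ≤ B)
    {c : ℝ} (s : Finset ℕ) (hc : ∀ i ∈ s, ∫ ω, H i (fun j => X j ω) ^ 2 ∂P ≤ c) :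
    ∫ ω, (∑ i ∈ s, H i (fun j => X j ω) * e i ω) ^ 2 ∂P
      ≤ s.card * (c * ∫ ω, e 0 ω ^ 2 ∂P) := by
  have hXm' : Measurable fun ω i => X i ω := measurable_pi_lambda _ hXm
  have hem' : Measurable fun ω i => e i ω := measurable_pi_lambda _ hem
  have := integral_sum_sq_le (P := P) s (Z := fun i ω => H i (fun j => X j ω) * e i ω)
    (c := c * ∫ ω, e 0 ω ^ 2 ∂P) (κ := 1) ?_ ?_ (fun j => {j})
    (fun _ _ => by simp) ?_
  · simpa using this
  · intro i _
    have he : MemLp (e i) 2 P := (hident i).memLp_iff.2 he2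
    refine (he.const_mul B).mono (((hH i).comp hXm').mul (hem i)).aestronglyMeasurable
      (Eventually.of_forall fun ω => ?_)
    rw [norm_mul, norm_mul]
    exact mul_le_mul_of_nonneg_right ((hB i _).trans (le_abs_self B)) (norm_nonneg _)
  · intro i hi
    have h1 := hXe.integral_fun_comp_mul_comp (f := fun x => H i x ^ 2) (g := fun z => z i ^ 2)
      hXm'.aemeasurable hem'.aemeasurable ((hH i).pow_const 2).aestronglyMeasurable
      ((measurable_pi_apply i).pow_const 2).aestronglyMeasurable
    simp_rw [mul_pow]
    rw [h1]
    have h2 : ∫ ω, e i ω ^ 2 ∂P = ∫ ω, e 0 ω ^ 2 ∂P :=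
      ((hident i).comp (measurable_id.pow_const 2)).integral_eq
    rw [h2]
    gcongr
    exact hc i hi
  · intro i _ j _ hij
    have hij : i ≠ j := by
      rintro rfl
      simp at hij
    have h1 := hXe.integral_fun_comp_mul_comp (f := fun x => H i x * H j x)
      (g := fun z => z i * z j)
      hXm'.aemeasurable hem'.aemeasurable ((hH i).mul (hH j)).aestronglyMeasurable
      ((measurable_pi_apply i).mul (measurable_pi_apply j)).aestronglyMeasurable
    have h2 : ∫ ω, e i ω * e j ω ∂P = 0 := by
      rw [(he.indepFun hij).integral_fun_mul_eq_mul_integral (hem i).aestronglyMeasurable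
        (hem j).aestronglyMeasurable, (hident i).integral_eq, he0, zero_mul]
    rw [h2, mul_zero] at h1
    rw [← h1]
    congr with ω
    ring

/-- Convergence in probability from convergence to zero of absolute moments. -/
lemma tendstoInMeasure_zero_of_moment {Z : ℕ → Ω → ℝ} {a : ℕ → ℝ} {k : ℕ}
    (hZ : ∀ᶠ n in atTop, Integrable (fun ω => |Z n ω| ^ k) P ∧ ∫ ω, |Z n ω| ^ k ∂P ≤ a n)
    (ha : Tendsto a atTop (𝓝 0)) : TendstoInMeasure P Z atTop 0 := by
  rw [tendstoInMeasure_iff_measureReal_norm]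
  intro ε hε
  have h1 : Tendsto (fun n => a n / ε ^ k) atTop (𝓝 0) := by
    simpa using ha.div_const (ε ^ k)
  refine tendsto_of_tendsto_of_tendsto_of_le_of_le' tendsto_const_nhds h1
    (Eventually.of_forall fun n => measureReal_nonneg) ?_
  filter_upwards [hZ] with n hn
  rw [le_div_iff₀ (by positivity), mul_comm]
  refine le_trans ?_ hn.2
  refine le_trans ?_ (mul_meas_ge_le_integral_of_nonneg
    (Eventually.of_forall fun ω => by positivity) hn.1 (ε ^ k))
  refine mul_le_mul_of_nonneg_left (measureReal_mono fun ω hω => ?_) (by positivity)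
  simp only [Pi.zero_apply, sub_zero, Set.mem_ofPred_eq, Real.norm_eq_abs] at hω ⊢
  gcongr

lemma MeasureTheory.TendstoInMeasure.add_zero_real {Z W : ℕ → Ω → ℝ}
    (hZ : TendstoInMeasure P Z atTop 0) (hW : TendstoInMeasure P W atTop 0) :
    TendstoInMeasure P (fun n ω => Z n ω + W n ω) atTop 0 := by
  rw [tendstoInMeasure_iff_measureReal_norm] at *
  intro ε hε
  have := (hZ (ε / 2) (by positivity)).add (hW (ε / 2) (by positivity))
  rw [add_zero] at this
  refine squeeze_zero (fun n => measureReal_nonneg) (fun n => ?_) this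
  refine le_trans (measureReal_mono ?_) (measureReal_union_le _ _)
  intro ω hω
  simp only [Pi.zero_apply, sub_zero, Set.mem_ofPred_eq, Set.mem_union] at hω ⊢
  by_contra! hcon
  have := norm_add_le (Z n ω) (W n ω)
  linarith

/-- Convergence to zero in probability is not affected by events of vanishing probability. -/
lemma MeasureTheory.TendstoInMeasure.of_eq_off {Z W : ℕ → Ω → ℝ} {A : ℕ → Set Ω}
    (hZ : TendstoInMeasure P Z atTop 0) (hA : Tendsto (fun n => P.real (A n)) atTop (𝓝 0))
    (h : ∀ᶠ n in atTop, ∀ᵐ ω ∂P, ω ∉ A n → W n ω = Z n ω) : TendstoInMeasure P W atTop 0 := by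
  rw [tendstoInMeasure_iff_measureReal_norm] at *
  intro ε hε
  have := (hZ ε hε).add hA
  rw [add_zero] at this
  refine tendsto_of_tendsto_of_tendsto_of_le_of_le' tendsto_const_nhds this
    (Eventually.of_forall fun n => measureReal_nonneg) ?_
  filter_upwards [h] with n hn
  refine le_trans ?_ (measureReal_union_le _ _)
  refine ENNReal.toReal_mono (measure_ne_top _ _) (measure_mono_ae ?_)
  filter_upwards [hn] with ω hω hεω
  by_cases hAω : ω ∈ A n
  · exact Or.inr hAω
  · left
    have hεω' : ε ≤ ‖W n ω - (0 : Ω → ℝ) ω‖ := hεω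
    rw [hω hAω] at hεω'
    exact hεω'

end Probability

/-! ### Inverting a truncated denominator -/

section Algebra

/-- Truncation at `b / 2` fixes `s` and is 1-Lipschitz, and the product of the two denominators is
at least `b ^ 2 / 2`. -/
lemma abs_inv_max_sub_inv_le {b s t : ℝ} (hb : 0 < b) (hs : b ≤ s) :
    |(max t (b / 2))⁻¹ - s⁻¹| ≤ 2 / b ^ 2 * |t - s| := by
  have hm : b / 2 ≤ max t (b / 2) := le_max_right _ _
  have hm0 : 0 < max t (b / 2) := by linarith
  have hs0 : 0 < s := by linarith
  have h1 : |max t (b / 2) - s| ≤ |t - s| := by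
    have : max s (b / 2) = s := max_eq_left (by linarith)
    nth_rewrite 1 [← this]
    exact abs_max_sub_max_le_abs t s (b / 2)
  rw [inv_sub_inv hm0.ne' hs0.ne', abs_div, abs_of_pos (mul_pos hm0 hs0), abs_sub_comm,
    div_mul_eq_mul_div, div_le_div_iff₀ (mul_pos hm0 hs0) (by positivity)]
  have h2 : b ^ 2 / 2 ≤ max t (b / 2) * s := by nlinarith
  calc _ ≤ |t - s| * b ^ 2 := by gcongr
    _ ≤ 2 * |t - s| * (max t (b / 2) * s) := by nlinarith [abs_nonneg (t - s)]

/-- `2 / s - t / s ^ 2` is the tangent to the inverse at `s`. For `t ≥ b / 2` the error is exactly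
`(t - s) ^ 2 / (t * s ^ 2)`. For `t ≤ b / 2` one has `s - t ≥ b / 2`, so even discrepancies linear
in `s - t` are quadratic up to a factor `2 / b`. -/
lemma abs_inv_max_sub_taylor_le {b s t : ℝ} (hb : 0 < b) (hs : b ≤ s) :
    |(max t (b / 2))⁻¹ - (2 / s - t / s ^ 2)| ≤ 4 / b ^ 3 * (t - s) ^ 2 := by
  have hs0 : 0 < s := by linarith
  rcases le_total (b / 2) t with h | h
  · rw [max_eq_left h]
    have ht : 0 < t := by linarith
    have : t⁻¹ - (2 / s - t / s ^ 2) = (t - s) ^ 2 / (t * s ^ 2) := by field_simp; ring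
    rw [this, abs_of_nonneg (by positivity), div_mul_eq_mul_div,
      div_le_div_iff₀ (by positivity) (by positivity)]
    have h2 : b ^ 3 ≤ 4 * (t * s ^ 2) := by
      have : b ^ 2 ≤ s ^ 2 := by gcongr
      nlinarith [mul_le_mul h this (by positivity) (by positivity)]
    nlinarith [sq_nonneg (t - s), mul_le_mul_of_nonneg_left h2 (sq_nonneg (t - s))]
  · rw [max_eq_right h]
    have hst : b / 2 ≤ s - t := by linarith
    have e : (b / 2)⁻¹ - (2 / s - t / s ^ 2)
        = ((s - b / 2) ^ 2 * 2 / b - (b / 2 - t)) / s ^ 2 := by field_simp; ring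
    have h1 : |(s - b / 2) ^ 2 * 2 / b - (b / 2 - t)| ≤ 4 / b * (t - s) ^ 2 := by
      have p1 : (s - b / 2) ^ 2 ≤ (t - s) ^ 2 := by nlinarith
      have p2 : b / 2 - t ≤ 2 / b * (t - s) ^ 2 := by
        rw [div_mul_eq_mul_div, le_div_iff₀ hb]
        nlinarith
      have p3 : (s - b / 2) ^ 2 * 2 / b ≤ 2 / b * (t - s) ^ 2 := by
        rw [mul_div_assoc, mul_comm]; gcongr
      have p4 : 0 ≤ (s - b / 2) ^ 2 * 2 / b := by positivity
      have p5 : 4 / b * (t - s) ^ 2 = 2 / b * (t - s) ^ 2 + 2 / b * (t - s) ^ 2 := by ring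
      rw [abs_le]
      constructor <;> linarith
    rw [e, abs_div, abs_of_pos (by positivity : 0 < s ^ 2), div_le_iff₀ (by positivity)]
    refine h1.trans ?_
    have h3 : b ^ 2 ≤ s ^ 2 := by gcongr
    have h4 : 4 / b = 4 / b ^ 3 * b ^ 2 := by field_simp
    rw [h4]
    have : 0 ≤ 4 / b ^ 3 * (t - s) ^ 2 := by positivity
    nlinarith

lemma Finset.sum_offDiag_eq_sum_erase {ι : Type*} [DecidableEq ι] (s : Finset ι)
    (F : ι → ι → ℝ) :
    ∑ p ∈ s.offDiag, F p.1 p.2 = ∑ i ∈ s, ∑ j ∈ s.erase i, F i j :=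
  Finset.sum_finset_product' s.offDiag s (fun i => s.erase i) (by
    rintro ⟨i, j⟩
    simp only [Finset.mem_offDiag, Finset.mem_erase]
    tauto)

end Algebra

/-! ### The leave-one-out density estimator -/

section Density

variable {d : ℕ}

local notation "𝔼" => EuclideanSpace ℝ (Fin d)

/-- The measure with density `f`. -/
noncomputable def densityMeasure (f : 𝔼 → ℝ) : Measure 𝔼 :=
  volume.withDensity fun x => ENNReal.ofReal (f x)

lemma integral_densityMeasure {f : 𝔼 → ℝ} (hfm : Measurable f) (hf0 : ∀ x, 0 ≤ f x)
    (F : 𝔼 → ℝ) : ∫ x, F x ∂(densityMeasure f) = ∫ x, F x * f x := by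
  rw [densityMeasure, integral_withDensity_eq_integral_toReal_smul hfm.ennreal_ofReal
    (Eventually.of_forall fun x => ENNReal.ofReal_lt_top)]
  congr with x
  rw [ENNReal.toReal_ofReal (hf0 x), smul_eq_mul, mul_comm]

variable {r : ℕ} {K f : EuclideanSpace ℝ (Fin d) → ℝ}

lemma integral_scaled_kernel_densityMeasure (hfm : Measurable f) (hf0 : ∀ x, 0 ≤ f x) {h : ℝ}
    (hh : 0 < h) (x : 𝔼) :
    ∫ y, K (h⁻¹ • (y - x)) ∂(densityMeasure f) = h ^ d * kernelSmooth K h f x := by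
  rw [integral_densityMeasure hfm hf0, integral_scaled_kernel_mul K f hh]

lemma measurable_scaled_kernel (hK : Measurable K) (h : ℝ) :
    Measurable fun p : 𝔼 × 𝔼 => K (h⁻¹ • (p.2 - p.1)) :=
  hK.comp (by fun_prop)

/-- One factor `|K|` is bounded by `C` and the density by `M`; the other factor is integrated, and
its change of variables yields `h ^ d`. -/
lemma IsKernelOfOrder.integral_scaled_sq_le (hK : IsKernelOfOrder r K) (hfm : Measurable f)
    (hf0 : ∀ x, 0 ≤ f x) {C M : ℝ} (hC : ∀ u, |K u| ≤ C) (hM : ∀ x, f x ≤ M) {h : ℝ}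
    (hh : 0 < h) (x : 𝔼) :
    ∫ y, K (h⁻¹ • (y - x)) ^ 2 ∂(densityMeasure f) ≤ h ^ d * (C * (∫ v, |K v|) * M) := by
  rw [integral_densityMeasure hfm hf0]
  have hC0 : 0 ≤ C := (abs_nonneg _).trans (hC 0)
  have e : h ^ d * (C * (∫ v, |K v|) * M)
      = ∫ y, (C * M) * |K (h⁻¹ • (y - x))| := by
    rw [integral_const_mul, integral_comp_inv_smul_sub (fun v => |K v|) hh x]
    ring
  have hint : Integrable fun y : 𝔼 => |K (h⁻¹ • (y - x))| :=
    ((hK.integrable.abs.comp_smul (inv_ne_zero hh.ne')).comp_sub_right x)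
  rw [e]
  refine integral_mono_of_nonneg (Eventually.of_forall fun y => mul_nonneg (sq_nonneg _) (hf0 y))
    (hint.const_mul _) (Eventually.of_forall fun y => ?_)
  dsimp only
  rw [← sq_abs]
  calc |K (h⁻¹ • (y - x))| ^ 2 * f y ≤ (C * |K (h⁻¹ • (y - x))|) * M := by
        rw [sq]
        gcongr
        · exact hf0 y
        · exact hC _
        · exact hM y
    _ = _ := by ring

/-- The centered kernel term. -/
noncomputable def centeredKernel (K f : 𝔼 → ℝ) (h : ℝ) (x y : 𝔼) : ℝ :=
  K (h⁻¹ • (y - x)) - h ^ d * kernelSmooth K h f x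

lemma measurable_centeredKernel (hK : Measurable K) (hfm : Measurable f) (h : ℝ) :
    Measurable (Function.uncurry (centeredKernel K f h)) :=
  (measurable_scaled_kernel hK h).sub
    (((measurable_kernelSmooth hK hfm h).comp measurable_fst).const_mul _)

variable [IsProbabilityMeasure (densityMeasure f)]

lemma abs_scaled_kernelSmooth_le (hfm : Measurable f)
    (hf0 : ∀ x, 0 ≤ f x) {C : ℝ} (hC : ∀ u, |K u| ≤ C) {h : ℝ} (hh : 0 < h) (x : 𝔼) :
    |h ^ d * kernelSmooth K h f x| ≤ C := by
  rw [← integral_scaled_kernel_densityMeasure hfm hf0 hh, ← Real.norm_eq_abs]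
  simpa using norm_integral_le_of_norm_le_const (μ := densityMeasure f) (C := C)
    (f := fun y => K (h⁻¹ • (y - x))) (Eventually.of_forall fun y => hC _)

lemma abs_centeredKernel_le (hfm : Measurable f)
    (hf0 : ∀ x, 0 ≤ f x) {C : ℝ} (hC : ∀ u, |K u| ≤ C) {h : ℝ} (hh : 0 < h) (x y : 𝔼) :
    |centeredKernel K f h x y| ≤ 2 * C := by
  refine (abs_sub _ _).trans ?_
  linarith [hC (h⁻¹ • (y - x)), abs_scaled_kernelSmooth_le hfm hf0 hC hh x]

lemma integrable_scaled_kernel (hK : Measurable K) {C : ℝ} (hC : ∀ u, |K u| ≤ C) (h : ℝ) (x : 𝔼) :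
    Integrable (fun y => K (h⁻¹ • (y - x))) (densityMeasure f) :=
  integrable_of_abs_le ((measurable_scaled_kernel hK h).comp measurable_prodMk_left).aemeasurable
    fun _ => hC _

lemma integral_centeredKernel (hK : Measurable K) (hfm : Measurable f)
    (hf0 : ∀ x, 0 ≤ f x) {C : ℝ} (hC : ∀ u, |K u| ≤ C) {h : ℝ} (hh : 0 < h) (x : 𝔼) :
    ∫ y, centeredKernel K f h x y ∂(densityMeasure f) = 0 := by
  unfold centeredKernel
  rw [integral_sub (integrable_scaled_kernel hK hC h x) (integrable_const _),
    integral_scaled_kernel_densityMeasure hfm hf0 hh]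
  simp

/-- The subtracted quantity is the mean, and a variance is at most the raw second moment. -/
lemma IsKernelOfOrder.integral_centeredKernel_sq_le (hK : IsKernelOfOrder r K)
    (hfm : Measurable f) (hf0 : ∀ x, 0 ≤ f x) {C M : ℝ} (hC : ∀ u, |K u| ≤ C)
    (hM : ∀ x, f x ≤ M) {h : ℝ} (hh : 0 < h) (x : 𝔼) :
    ∫ y, centeredKernel K f h x y ^ 2 ∂(densityMeasure f)
      ≤ h ^ d * (C * (∫ v, |K v|) * M) := by
  refine le_trans ?_ (hK.integral_scaled_sq_le hfm hf0 hC hM hh x)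
  have hm := (measurable_scaled_kernel hK.measurable h).comp (measurable_prodMk_left (x := x))
  have i1 : Integrable (fun y => K (h⁻¹ • (y - x))) (densityMeasure f) :=
    integrable_scaled_kernel hK.measurable hC h x
  have i2 : Integrable (fun y => K (h⁻¹ • (y - x)) ^ 2) (densityMeasure f) :=
    (memLp_of_abs_le hm.aemeasurable fun y => hC _).integrable_sq
  set m := h ^ d * kernelSmooth K h f x with hmdef
  have e : ∀ y, centeredKernel K f h x y ^ 2
      = K (h⁻¹ • (y - x)) ^ 2 - (2 * m * K (h⁻¹ • (y - x)) - m ^ 2) := fun y => by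
    rw [centeredKernel]; ring
  simp_rw [e]
  have i3 : Integrable (fun y => 2 * m * K (h⁻¹ • (y - x)) - m ^ 2) (densityMeasure f) :=
    (i1.const_mul _).sub (integrable_const _)
  rw [integral_sub i2 i3,
    integral_sub (i1.const_mul _) (integrable_const _), integral_const_mul,
    integral_scaled_kernel_densityMeasure hfm hf0 hh, ← hmdef]
  simp only [integral_const, probReal_univ, one_smul]
  nlinarith [sq_nonneg m]

/-- There are `n - 1` summands but the normalization is by `n`, so the mean given `x i` is `1 - 1 /
n` times the smoothed density. This is the origin of the `1 / n` terms in the error bounds. -/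
lemma looDensity_eq_centered (K f : 𝔼 → ℝ) {h : ℝ} (hh : 0 < h) {n : ℕ}
    {i : ℕ} (hi : i < n) (x : ℕ → 𝔼) :
    looDensity K h n x i (x i)
      = ((n : ℝ) * h ^ d)⁻¹ * (∑ j ∈ (Finset.range n).erase i, centeredKernel K f h (x i) (x j))
        + (kernelSmooth K h f (x i) - kernelSmooth K h f (x i) / n) := by
  have hn : (0 : ℝ) < n := by exact_mod_cast (by omega : 0 < n)
  have hcard : (((Finset.range n).erase i).card : ℝ) = n - 1 := by
    rw [Finset.card_erase_of_mem (Finset.mem_range.2 hi), Finset.card_range,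
      Nat.cast_sub (by omega)]
    simp
  simp only [looDensity, centeredKernel, Finset.sum_sub_distrib, Finset.sum_const, nsmul_eq_mul,
    hcard]
  have : h ^ d ≠ 0 := by positivity
  field_simp
  ring

lemma measurable_looDensity (hK : Measurable K) (h : ℝ) (n i : ℕ) :
    Measurable fun x : ℕ → 𝔼 => looDensity K h n x i (x i) := by
  unfold looDensity
  refine Measurable.const_mul (Finset.measurable_sum _ fun j _ => ?_) _
  exact hK.comp (by fun_prop)

lemma abs_looDensity_le {C : ℝ} (hC : ∀ u, |K u| ≤ C) (h : ℝ) (n i : ℕ) (x : ℕ → 𝔼) (y : 𝔼) :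
    |looDensity K h n x i y|
      ≤ |((n : ℝ) * h ^ d)⁻¹| * (((Finset.range n).erase i).card * C) := by
  rw [looDensity, abs_mul]
  gcongr
  refine (Finset.abs_sum_le_sum_abs _ _).trans ((Finset.sum_le_card_nsmul _ _ C
    fun j _ => hC _).trans_eq (nsmul_eq_mul _ _))

variable {Ω : Type*} [MeasurableSpace Ω] {P : Measure Ω} [IsProbabilityMeasure P]
  {X : ℕ → Ω → EuclideanSpace ℝ (Fin d)}

/-- Mean square error of the leave-one-out density estimator. -/
lemma IsKernelOfOrder.integral_looDensity_sub_sq_le (hK : IsKernelOfOrder r K)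
    (hfm : Measurable f) (hf0 : ∀ x, 0 ≤ f x) {C M : ℝ} (hC : ∀ u, |K u| ≤ C)
    (hM : ∀ x, f x ≤ M) {h : ℝ} (hh : 0 < h) {B : ℝ}
    (hB : ∀ x, |kernelSmooth K h f x - f x| ≤ B)
    (hX : iIndepFun X P) (hXm : ∀ i, Measurable (X i))
    (hlaw : ∀ i, HasLaw (X i) (densityMeasure f) P) {n i : ℕ} (hi : i < n) :
    ∫ ω, (looDensity K h n (fun j => X j ω) i (X i ω) - f (X i ω)) ^ 2 ∂P
      ≤ 2 * (C * (∫ v, |K v|) * M) / (n * h ^ d) + 2 * (B + (∫ v, |K v|) * M / n) ^ 2 := by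
  have hn : (0 : ℝ) < n := by exact_mod_cast (by omega : 0 < n)
  have hhd : 0 < h ^ d := by positivity
  set A := ∫ v, |K v|
  have hfM : ∀ x, |f x| ≤ M := fun x => by rw [abs_of_nonneg (hf0 x)]; exact hM x
  set S : Ω → ℝ := fun ω =>
    ∑ j ∈ (Finset.range n).erase i, centeredKernel K f h (X i ω) (X j ω) with hS
  have hSm : Measurable S := Finset.measurable_sum _ fun j _ =>
    (measurable_centeredKernel hK.measurable hfm h).comp ((hXm i).prodMk (hXm j))
  have hSb : ∀ ω, |S ω| ≤ ((Finset.range n).erase i).card * (2 * C) := fun ω =>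
    (Finset.abs_sum_le_sum_abs _ _).trans ((Finset.sum_le_card_nsmul _ _ (2 * C)
      fun j _ => abs_centeredKernel_le hfm hf0 hC hh _ _).trans_eq (nsmul_eq_mul _ _))
  have hS2 : ∫ ω, S ω ^ 2 ∂P ≤ n * (h ^ d * (C * A * M)) := by
    refine (integral_sum_erase_sq_le hX hXm hlaw (measurable_centeredKernel hK.measurable hfm h)
      (abs_centeredKernel_le hfm hf0 hC hh) (integral_centeredKernel hK.measurable hfm hf0 hC hh)
      (fun x => hK.integral_centeredKernel_sq_le hfm hf0 hC hM hh x) i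
      (S := (Finset.range n).erase i) (by simp)).trans ?_
    have h0 : 0 ≤ h ^ d * (C * A * M) := (integral_nonneg fun y => sq_nonneg _).trans
      (hK.integral_centeredKernel_sq_le hfm hf0 hC hM hh 0)
    gcongr
    exact (Finset.card_le_card (Finset.erase_subset _ _)).trans_eq (Finset.card_range n)
  have hSint := (memLp_of_abs_le (P := P) hSm.aemeasurable hSb).integrable_sq
  -- Splitting by `(a + b)² ≤ 2a² + 2b²` into the centered sum and a deterministic bound for the
  -- bias.
  have hpt : ∀ ω, (looDensity K h n (fun j => X j ω) i (X i ω) - f (X i ω)) ^ 2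
      ≤ 2 * (((n : ℝ) * h ^ d)⁻¹) ^ 2 * S ω ^ 2 + 2 * (B + A * M / n) ^ 2 := by
    intro ω
    rw [looDensity_eq_centered K f hh hi (fun j => X j ω)]
    change (_ * S ω + _ - _) ^ 2 ≤ _
    set x := X i ω
    have hb : |kernelSmooth K h f x - kernelSmooth K h f x / n - f x| ≤ B + A * M / n := by
      have h1 := hB x
      have h2 := hK.abs_kernelSmooth_le hfM h x
      have h3 : |kernelSmooth K h f x / n| ≤ A * M / n := by
        rw [abs_div, abs_of_pos hn]; gcongr
      calc _ = |(kernelSmooth K h f x - f x) - kernelSmooth K h f x / n| := by ring_nf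
        _ ≤ _ := (abs_sub _ _).trans (add_le_add h1 h3)
    have hb2 := sq_le_sq' (abs_le.1 hb).1 (abs_le.1 hb).2
    nlinarith [sq_nonneg (((n : ℝ) * h ^ d)⁻¹ * S ω
      - (kernelSmooth K h f x - kernelSmooth K h f x / n - f x))]
  calc _ ≤ ∫ ω, (2 * (((n : ℝ) * h ^ d)⁻¹) ^ 2 * S ω ^ 2 + 2 * (B + A * M / n) ^ 2) ∂P :=
        integral_mono_of_nonneg (Eventually.of_forall fun ω => sq_nonneg _)
          ((hSint.const_mul _).add (integrable_const _)) (Eventually.of_forall hpt)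
    _ = 2 * (((n : ℝ) * h ^ d)⁻¹) ^ 2 * (∫ ω, S ω ^ 2 ∂P) + 2 * (B + A * M / n) ^ 2 := by
        rw [integral_add (hSint.const_mul _) (integrable_const _), integral_const_mul]
        simp
    _ ≤ 2 * (((n : ℝ) * h ^ d)⁻¹) ^ 2 * (n * (h ^ d * (C * A * M)))
        + 2 * (B + A * M / n) ^ 2 := by gcongr
    _ = _ := by
        congr 1
        field_simp

/-- The leave-one-out estimator is bounded away from zero with large probability. -/
lemma IsKernelOfOrder.measureReal_looDensity_lt_le (hK : IsKernelOfOrder r K)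
    (hfm : Measurable f) (hf0 : ∀ x, 0 ≤ f x) {C M : ℝ} (hC : ∀ u, |K u| ≤ C)
    (hM : ∀ x, f x ≤ M) {h : ℝ} (hh : 0 < h) {B : ℝ}
    (hB : ∀ x, |kernelSmooth K h f x - f x| ≤ B)
    (hX : iIndepFun X P) (hXm : ∀ i, Measurable (X i))
    (hlaw : ∀ i, HasLaw (X i) (densityMeasure f) P) {n i : ℕ} (hi : i < n)
    {b : ℝ} (hBn : B + (∫ v, |K v|) * M / n ≤ b / 4)
    {l : ℝ} (hl : 0 ≤ l) (hlC : l * (2 * C) ≤ 1) (hls : l * (C * (∫ v, |K v|) * M) ≤ b / 8) :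
    P.real {ω | b ≤ f (X i ω) ∧ looDensity K h n (fun j => X j ω) i (X i ω) < b / 2}
      ≤ Real.exp (-(l * b / 8) * (n * h ^ d)) := by
  have hn : (0 : ℝ) < n := by exact_mod_cast (by omega : 0 < n)
  have hhd : 0 < h ^ d := by positivity
  set A := ∫ v, |K v|
  have hfM : ∀ x, |f x| ≤ M := fun x => by rw [abs_of_nonneg (hf0 x)]; exact hM x
  have h0 : 0 ≤ h ^ d * (C * A * M) := (integral_nonneg fun y => sq_nonneg _).trans
    (hK.integral_centeredKernel_sq_le hfm hf0 hC hM hh 0)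
  -- The bias is at most `b / 4`, so a drop from `b` to below `b / 2` forces the centered sum below
  -- `-(b / 4) n h^d`. The bound is therefore applied to the negated kernel.
  have key := measureReal_sum_erase_ge_le hX hXm hlaw
    (ζ := fun x y => -centeredKernel K f h x y)
    (measurable_centeredKernel hK.measurable hfm h).neg (B := 2 * C)
    (fun x y => by rw [abs_neg]; exact abs_centeredKernel_le hfm hf0 hC hh x y)
    (fun x => by rw [integral_neg, integral_centeredKernel hK.measurable hfm hf0 hC hh, neg_zero])
    (s := h ^ d * (C * A * M))
    (fun x => by simpa only [neg_sq] using hK.integral_centeredKernel_sq_le hfm hf0 hC hM hh x)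
    hl hlC i (S := (Finset.range n).erase i) (by simp) (b / 4 * (n * h ^ d))
  refine (measureReal_mono ?_).trans (key.trans ?_)
  · rintro ω ⟨hω1, hω2⟩
    rw [looDensity_eq_centered K f hh hi (fun j => X j ω)] at hω2
    simp only [Set.mem_ofPred_eq, Finset.sum_neg_distrib]
    set S := ∑ j ∈ (Finset.range n).erase i, centeredKernel K f h (X i ω) (X j ω)
    set x := X i ω
    have h1 := (abs_le.1 (hB x)).1
    have h3 : kernelSmooth K h f x / n ≤ A * M / n := by
      gcongr; exact (le_abs_self _).trans (hK.abs_kernelSmooth_le hfM h x)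
    have h4 : ((n : ℝ) * h ^ d)⁻¹ * S < -(b / 4) := by linarith
    rw [inv_mul_lt_iff₀ (by positivity)] at h4
    linarith
  · rw [Real.exp_le_exp]
    have hc : (((Finset.range n).erase i).card : ℝ) ≤ n := by
      exact_mod_cast (Finset.card_le_card (Finset.erase_subset _ _)).trans_eq (Finset.card_range n)
    calc _ ≤ n * (l ^ 2 * (h ^ d * (C * A * M))) - l * (b / 4 * (n * h ^ d)) := by gcongr
      _ = (n * h ^ d) * l * (l * (C * A * M) - b / 4) := by ring
      _ ≤ (n * h ^ d) * l * (b / 8 - b / 4) := by gcongr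
      _ = _ := by ring

end Density

/-! ### Consequences of the bandwidth conditions -/

section Bandwidth

/-- Upper bound for the mean square error of the leave-one-out density estimator. -/
noncomputable def mseBound (d r : ℕ) (s A B : ℝ) (h : ℕ → ℝ) (n : ℕ) : ℝ :=
  2 * s / (n * h n ^ d) + 2 * (B * h n ^ r + A / n) ^ 2

variable {d r : ℕ} {h : ℕ → ℝ}

lemma tendsto_inv_sqrt_natCast : Tendsto (fun n : ℕ => (√(n : ℝ))⁻¹) atTop (𝓝 0) :=
  tendsto_inv_atTop_zero.comp (Real.tendsto_sqrt_atTop.comp tendsto_natCast_atTop_atTop)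

lemma tendsto_bandwidth_pow
    (hs : Tendsto (fun n : ℕ => √(n : ℝ) * h n ^ r) atTop (𝓝 0)) :
    Tendsto (fun n => h n ^ r) atTop (𝓝 0) := by
  have := hs.mul tendsto_inv_sqrt_natCast
  rw [mul_zero] at this
  refine this.congr' ?_
  filter_upwards [eventually_gt_atTop 0] with n hn
  have : 0 < √(n : ℝ) := Real.sqrt_pos.2 (by exact_mod_cast hn)
  field_simp

lemma tendsto_bandwidth (hpos : ∀ᶠ n in atTop, 0 < h n)
    (hs : Tendsto (fun n : ℕ => √(n : ℝ) * h n ^ r) atTop (𝓝 0)) :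
    Tendsto h atTop (𝓝 0) := by
  rw [Metric.tendsto_nhds]
  intro ε hε
  have := (tendsto_bandwidth_pow hs).eventually_lt_const (u := ε ^ r) (by positivity)
  filter_upwards [this, hpos] with n h1 h2
  rw [Real.dist_0_eq_abs, abs_of_pos h2]
  exact lt_of_pow_lt_pow_left₀ r hε.le h1

/-- The variance term times `√n` is a multiple of `1 / (√n h^d)`. In the squared bias one factor
absorbs `√n` and still tends to zero, as does the other. -/
lemma tendsto_sqrt_mul_mseBound (s A B : ℝ)
    (hs : Tendsto (fun n : ℕ => √(n : ℝ) * h n ^ r) atTop (𝓝 0))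
    (hl : Tendsto (fun n : ℕ => √(n : ℝ) * h n ^ d) atTop atTop) :
    Tendsto (fun n : ℕ => √(n : ℝ) * mseBound d r s A B h n) atTop (𝓝 0) := by
  have h1 : Tendsto (fun n : ℕ => 2 * s * (√(n : ℝ) * h n ^ d)⁻¹) atTop (𝓝 (2 * s * 0)) :=
    (tendsto_inv_atTop_zero.comp hl).const_mul _
  have h2 : Tendsto (fun n : ℕ => B * (√(n : ℝ) * h n ^ r) + A * (√(n : ℝ))⁻¹) atTop
      (𝓝 (B * 0 + A * 0)) := (hs.const_mul B).add (tendsto_inv_sqrt_natCast.const_mul A)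
  have h3 : Tendsto (fun n : ℕ => B * h n ^ r + A * ((√(n : ℝ))⁻¹ * (√(n : ℝ))⁻¹)) atTop
      (𝓝 (B * 0 + A * (0 * 0))) := ((tendsto_bandwidth_pow hs).const_mul B).add
    ((tendsto_inv_sqrt_natCast.mul tendsto_inv_sqrt_natCast).const_mul A)
  have h4 := h1.add ((h2.mul h3).const_mul 2)
  have e : 2 * s * 0 + 2 * ((B * 0 + A * 0) * (B * 0 + A * (0 * 0))) = (0 : ℝ) := by ring
  rw [e] at h4
  refine h4.congr' ?_
  filter_upwards [eventually_gt_atTop 0] with n hn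
  have hn' : (0 : ℝ) < n := by exact_mod_cast hn
  obtain ⟨q, hq, hqn⟩ : ∃ q : ℝ, 0 < q ∧ (n : ℝ) = q ^ 2 :=
    ⟨√(n : ℝ), Real.sqrt_pos.2 hn', (Real.sq_sqrt hn'.le).symm⟩
  rw [mseBound, hqn, Real.sqrt_sq hq.le]
  by_cases hh : h n ^ d = 0
  · simp only [hh]
    field_simp
  · field_simp

lemma mseBound_nonneg {s A B : ℝ} (hs : 0 ≤ s) {n : ℕ} (hn : 0 < h n) :
    0 ≤ mseBound d r s A B h n := by
  unfold mseBound
  positivity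

lemma tendsto_mseBound {s : ℝ} (hs0 : 0 ≤ s) (A B : ℝ) (hpos : ∀ᶠ n in atTop, 0 < h n)
    (hs : Tendsto (fun n : ℕ => √(n : ℝ) * h n ^ r) atTop (𝓝 0))
    (hl : Tendsto (fun n : ℕ => √(n : ℝ) * h n ^ d) atTop atTop) :
    Tendsto (mseBound d r s A B h) atTop (𝓝 0) := by
  refine tendsto_of_tendsto_of_tendsto_of_le_of_le' tendsto_const_nhds
    (tendsto_sqrt_mul_mseBound s A B hs hl) ?_ ?_
  · filter_upwards [hpos] with n hn using mseBound_nonneg hs0 hn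
  · filter_upwards [hpos, eventually_ge_atTop 1] with n hn h1
    have : 1 ≤ √(n : ℝ) := by rw [Real.one_le_sqrt]; exact_mod_cast h1
    exact le_mul_of_one_le_left (mseBound_nonneg hs0 hn) this

/-- The prefactor `n` comes from a union bound over the sample. Once `√n h^d ≥ 1`, the exponent `n
h^d` is at least `√n`, and `x² exp (-c x)` at `x = √n` dominates. -/
lemma tendsto_mul_exp_neg_bandwidth {c : ℝ} (hc : 0 < c)
    (hl : Tendsto (fun n : ℕ => √(n : ℝ) * h n ^ d) atTop atTop) :
    Tendsto (fun n : ℕ => n * Real.exp (-c * (n * h n ^ d))) atTop (𝓝 0) := by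
  have h1 : Tendsto (fun x : ℝ => x ^ 2 * Real.exp (-c * x)) atTop (𝓝 0) := by
    have := Real.tendsto_pow_mul_exp_neg_atTop_nhds_zero 2
    have h2 := (this.comp (tendsto_id.const_mul_atTop hc)).const_mul (c ^ 2)⁻¹
    rw [mul_zero] at h2
    refine h2.congr fun x => ?_
    simp only [Function.comp, id]
    field_simp
  have h2 := h1.comp (Real.tendsto_sqrt_atTop.comp tendsto_natCast_atTop_atTop)
  refine tendsto_of_tendsto_of_tendsto_of_le_of_le' tendsto_const_nhds h2
    (Eventually.of_forall fun n => by positivity) ?_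
  filter_upwards [hl.eventually_ge_atTop 1] with n hn
  simp only [Function.comp]
  rw [Real.sq_sqrt (Nat.cast_nonneg n)]
  gcongr ?_ * ?_
  rw [Real.exp_le_exp]
  have h3 : √(n : ℝ) ≤ n * h n ^ d := by
    have h4 : (n : ℝ) = √(n : ℝ) * √(n : ℝ) := (Real.mul_self_sqrt (Nat.cast_nonneg n)).symm
    rw [h4, mul_assoc, Real.sqrt_mul_self (Real.sqrt_nonneg _)]
    exact le_mul_of_one_le_right (Real.sqrt_nonneg _) hn
  nlinarith

end Bandwidth

/-! ### Truncation event, noise term and quadratic remainder -/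

section Estimator

set_option linter.unusedSectionVars false

variable {d : ℕ}

/-- A bounded density and a kernel for which the smoothing bias is at most `B * h ^ r`. -/
structure SmoothingModel (r : ℕ) (K f : EuclideanSpace ℝ (Fin d) → ℝ) (C M B : ℝ) : Prop where
  kernel : IsKernelOfOrder r K
  measurable : Measurable f
  nonneg : ∀ x, 0 ≤ f x
  kernel_le : ∀ u, |K u| ≤ C
  density_le : ∀ x, f x ≤ M
  bias_le : ∀ h, 0 < h → ∀ x, |kernelSmooth K h f x - f x| ≤ B * h ^ r

/-- An independent sample from the density `f`. -/
structure IsSampleFrom {Ω : Type*} [MeasurableSpace Ω] (P : Measure Ω)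
    (X : ℕ → Ω → EuclideanSpace ℝ (Fin d)) (f : EuclideanSpace ℝ (Fin d) → ℝ) : Prop where
  indep : iIndepFun X P
  measurable : ∀ i, Measurable (X i)
  law : ∀ i, HasLaw (X i) (densityMeasure f) P

/-- A bounded weight supported where the density is at least `b`. -/
structure IsBoundedWeight (f : EuclideanSpace ℝ (Fin d) → ℝ) (b : ℝ)
    (w : EuclideanSpace ℝ (Fin d) → ℝ) (W : ℝ) : Prop where
  measurable : Measurable w
  bdd : ∀ x, |w x| ≤ W
  support : ∀ x, w x ≠ 0 → b ≤ f x

variable {r : ℕ} {K f : EuclideanSpace ℝ (Fin d) → ℝ} {C M B : ℝ}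
  {Ω : Type*} [MeasurableSpace Ω] {P : Measure Ω} [IsProbabilityMeasure P]
  {X : ℕ → Ω → EuclideanSpace ℝ (Fin d)} {h : ℕ → ℝ} {b : ℝ}

lemma SmoothingModel.abs_density_le (hm : SmoothingModel r K f C M B)
    (x : EuclideanSpace ℝ (Fin d)) : |f x| ≤ M := by
  rw [abs_of_nonneg (hm.nonneg x)]; exact hm.density_le x

lemma SmoothingModel.const_nonneg (hm : SmoothingModel r K f C M B) :
    0 ≤ C * (∫ v, |K v|) * M := by
  have h1 : 0 ≤ C := (abs_nonneg _).trans (hm.kernel_le 0)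
  have h2 : 0 ≤ M := (hm.nonneg 0).trans (hm.density_le 0)
  have h3 : 0 ≤ ∫ v, |K v| := integral_nonneg fun v => abs_nonneg _
  positivity

lemma IsSampleFrom.isProbabilityMeasure (hX : IsSampleFrom P X f) :
    IsProbabilityMeasure (densityMeasure f) :=
  (hX.law 0).isProbabilityMeasure_iff.1 inferInstance

lemma IsSampleFrom.measurable_looDensity (hX : IsSampleFrom P X f) (hK : Measurable K)
    (a : ℝ) (n i : ℕ) : Measurable fun ω => looDensity K a n (fun j => X j ω) i (X i ω) :=
  (_root_.measurable_looDensity hK a n i).comp (measurable_pi_lambda _ hX.measurable)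

lemma SmoothingModel.integrable_looDensity_sub_sq (hm : SmoothingModel r K f C M B)
    (hX : IsSampleFrom P X f) (a : ℝ) (n i : ℕ) :
    Integrable (fun ω => (looDensity K a n (fun j => X j ω) i (X i ω) - f (X i ω)) ^ 2) P := by
  refine (memLp_of_abs_le (B := |((n : ℝ) * a ^ d)⁻¹| * (((Finset.range n).erase i).card * C) + M)
    ((hX.measurable_looDensity hm.kernel.measurable a n i).sub
      (hm.measurable.comp (hX.measurable i))).aemeasurable fun ω => ?_).integrable_sq
  exact (abs_sub _ _).trans (add_le_add (abs_looDensity_le hm.kernel_le _ _ _ _ _)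
    (hm.abs_density_le _))

lemma SmoothingModel.integral_looDensity_sub_sq_le (hm : SmoothingModel r K f C M B)
    (hX : IsSampleFrom P X f) {n : ℕ} (hn : 0 < h n) {i : ℕ} (hi : i < n) :
    ∫ ω, (looDensity K (h n) n (fun j => X j ω) i (X i ω) - f (X i ω)) ^ 2 ∂P
      ≤ mseBound d r (C * (∫ v, |K v|) * M) ((∫ v, |K v|) * M) B h n :=
  have := hX.isProbabilityMeasure
  hm.kernel.integral_looDensity_sub_sq_le hm.measurable hm.nonneg hm.kernel_le hm.density_le hn
    (hm.bias_le _ hn) hX.indep hX.measurable hX.law hi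

/-- With probability tending to one the density estimator is at least `b / 2` at all sample points
where the density is at least `b`. -/
lemma SmoothingModel.tendsto_measureReal_exists_lt (hm : SmoothingModel r K f C M B)
    (hX : IsSampleFrom P X f) (hb : 0 < b) (hpos : ∀ᶠ n in atTop, 0 < h n)
    (hs : Tendsto (fun n : ℕ => √(n : ℝ) * h n ^ r) atTop (𝓝 0))
    (hl : Tendsto (fun n : ℕ => √(n : ℝ) * h n ^ d) atTop atTop) :
    Tendsto (fun n => P.real {ω | ∃ i < n, b ≤ f (X i ω) ∧
      looDensity K (h n) n (fun j => X j ω) i (X i ω) < b / 2}) atTop (𝓝 0) := by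
  have := hX.isProbabilityMeasure
  have hC0 : 0 ≤ C := (abs_nonneg _).trans (hm.kernel_le 0)
  set s := C * (∫ v, |K v|) * M with hsdef
  have hs0 : 0 ≤ s := hm.const_nonneg
  -- The Chernoff parameter does not depend on `n`. The bound `b / 8` on `l * s` leaves half of the
  -- deviation `b / 4` in the exponent.
  obtain ⟨l, hl0, hl1, hl2⟩ : ∃ l : ℝ, 0 < l ∧ l * (2 * C) ≤ 1 ∧ l * s ≤ b / 8 := by
    refine ⟨(1 + 2 * C + 8 * s / b)⁻¹, by positivity, ?_, ?_⟩
    · rw [inv_mul_le_iff₀ (by positivity), mul_one]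
      have : 0 ≤ 8 * s / b := by positivity
      linarith
    · rw [inv_mul_le_iff₀ (by positivity)]
      have e : (1 + 2 * C + 8 * s / b) * (b / 8) = (1 + 2 * C) * (b / 8) + s := by field_simp
      rw [e]
      have : 0 ≤ (1 + 2 * C) * (b / 8) := by positivity
      linarith
  have hBn : Tendsto (fun n : ℕ => B * h n ^ r + (∫ v, |K v|) * M / n) atTop (𝓝 0) := by
    have := ((tendsto_bandwidth_pow hs).const_mul B).add
      (tendsto_const_div_atTop_nhds_zero_nat ((∫ v, |K v|) * M))
    simpa using this
  refine tendsto_of_tendsto_of_tendsto_of_le_of_le' tendsto_const_nhds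
    (tendsto_mul_exp_neg_bandwidth (c := l * b / 8) (by positivity) hl)
    (Eventually.of_forall fun n => measureReal_nonneg) ?_
  filter_upwards [hpos, hBn.eventually_le_const (by positivity : (0 : ℝ) < b / 4)] with n hn hBn
  have hset : {ω | ∃ i < n, b ≤ f (X i ω) ∧
      looDensity K (h n) n (fun j => X j ω) i (X i ω) < b / 2}
      = ⋃ i ∈ Finset.range n, {ω | b ≤ f (X i ω) ∧
      looDensity K (h n) n (fun j => X j ω) i (X i ω) < b / 2} := by
    ext ω
    simp only [Set.mem_ofPred_eq, Set.mem_iUnion, Finset.mem_range, exists_prop]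
  rw [hset]
  refine (measureReal_biUnion_finset_le _ _).trans ?_
  refine (Finset.sum_le_card_nsmul _ _ _ fun i hi =>
    hm.kernel.measureReal_looDensity_lt_le hm.measurable hm.nonneg hm.kernel_le hm.density_le hn
      (hm.bias_le _ hn) hX.indep hX.measurable hX.law (Finset.mem_range.1 hi) hBn hl0.le hl1
      hl2).trans_eq ?_
  simp

/-- The noise part is not affected by the estimation of the density. -/
lemma SmoothingModel.tendstoInMeasure_noise (hm : SmoothingModel r K f C M B)
    (hX : IsSampleFrom P X f) (hb : 0 < b) (hpos : ∀ᶠ n in atTop, 0 < h n)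
    (hs : Tendsto (fun n : ℕ => √(n : ℝ) * h n ^ r) atTop (𝓝 0))
    (hl : Tendsto (fun n : ℕ => √(n : ℝ) * h n ^ d) atTop atTop)
    {e : ℕ → Ω → ℝ} (hem : ∀ i, Measurable (e i))
    (he : iIndepFun e P) (hident : ∀ i, IdentDistrib (e i) (e 0) P P)
    (hXe : IndepFun (fun ω i => X i ω) (fun ω i => e i ω) P)
    (he2 : MemLp (e 0) 2 P) (he0 : ∫ ω, e 0 ω ∂P = 0)
    {τ : EuclideanSpace ℝ (Fin d) → ℝ} {T : ℝ} (hτ : IsBoundedWeight f b τ T) :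
    TendstoInMeasure P (fun (n : ℕ) ω => (√(n : ℝ))⁻¹ * ∑ i ∈ Finset.range n,
      (τ (X i ω) * ((max (looDensity K (h n) n (fun j => X j ω) i (X i ω)) (b / 2))⁻¹
        - (f (X i ω))⁻¹)) * e i ω) atTop 0 := by
  have hT0 : 0 ≤ T := (abs_nonneg _).trans (hτ.bdd 0)
  -- The weight of the `i`-th noise variable depends on the whole design but not on the noise, so
  -- distinct terms are orthogonal. Truncation keeps the weights bounded.
  let H : ℕ → ℕ → (ℕ → EuclideanSpace ℝ (Fin d)) → ℝ := fun n i x =>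
    τ (x i) * ((max (looDensity K (h n) n x i (x i)) (b / 2))⁻¹ - (f (x i))⁻¹)
  have hHm : ∀ n i, Measurable (H n i) := by
    intro n i
    have h1 := measurable_looDensity hm.kernel.measurable (h n) n i
    have h2 : Measurable fun x : ℕ → EuclideanSpace ℝ (Fin d) => f (x i) :=
      hm.measurable.comp (measurable_pi_apply i)
    exact (hτ.measurable.comp (measurable_pi_apply i)).mul
      ((h1.max measurable_const).inv.sub h2.inv)
  have hH0 : ∀ n i x, τ (x i) = 0 → H n i x = 0 := fun n i x h0 => by simp [H, h0]
  have hHb : ∀ n i x, |H n i x| ≤ T * (2 / b + 1 / b) := by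
    intro n i x
    by_cases h0 : τ (x i) = 0
    · rw [hH0 n i x h0, abs_zero]; positivity
    · have h1 := hτ.support _ h0
      have h2 : 0 < f (x i) := hb.trans_le h1
      have h3 : b / 2 ≤ max (looDensity K (h n) n x i (x i)) (b / 2) := le_max_right _ _
      have h4 : 0 < max (looDensity K (h n) n x i (x i)) (b / 2) := by linarith
      rw [abs_mul]
      gcongr
      · exact hτ.bdd _
      · refine (abs_sub _ _).trans (add_le_add ?_ ?_)
        · rw [abs_of_pos (inv_pos.2 h4), inv_le_comm₀ h4 (by positivity), inv_div]
          exact h3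
        · rw [abs_of_pos (inv_pos.2 h2), one_div]
          gcongr
  have hHsq : ∀ n i ω, H n i (fun j => X j ω) ^ 2
      ≤ (T * (2 / b ^ 2)) ^ 2
        * (looDensity K (h n) n (fun j => X j ω) i (X i ω) - f (X i ω)) ^ 2 := by
    intro n i ω
    by_cases h0 : τ (X i ω) = 0
    · rw [hH0 n i (fun j => X j ω) h0, zero_pow two_ne_zero]; positivity
    · rw [← mul_pow, sq_le_sq, abs_mul (T * (2 / b ^ 2)),
        abs_of_nonneg (by positivity : 0 ≤ T * (2 / b ^ 2)), mul_assoc, abs_mul]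
      exact mul_le_mul (hτ.bdd _) (abs_inv_max_sub_inv_le hb (hτ.support _ h0)) (abs_nonneg _) hT0
  set V := mseBound d r (C * (∫ v, |K v|) * M) ((∫ v, |K v|) * M) B h with hV
  have hVt : Tendsto V atTop (𝓝 0) := tendsto_mseBound hm.const_nonneg _ _ hpos hs hl
  refine tendstoInMeasure_zero_of_moment (k := 2)
    (a := fun n => (T * (2 / b ^ 2)) ^ 2 * V n * ∫ ω, e 0 ω ^ 2 ∂P) ?_ ?_
  · filter_upwards [hpos, eventually_gt_atTop 0] with n hn hn0
    have hn0' : (0 : ℝ) < n := by exact_mod_cast hn0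
    simp_rw [sq_abs, mul_pow]
    have hc : ∀ i ∈ Finset.range n, ∫ ω, H n i (fun j => X j ω) ^ 2 ∂P
        ≤ (T * (2 / b ^ 2)) ^ 2 * V n := by
      intro i hi
      calc _ ≤ ∫ ω, (T * (2 / b ^ 2)) ^ 2
            * (looDensity K (h n) n (fun j => X j ω) i (X i ω) - f (X i ω)) ^ 2 ∂P :=
            integral_mono_of_nonneg (Eventually.of_forall fun ω => sq_nonneg _)
              ((hm.integrable_looDensity_sub_sq hX _ _ _).const_mul _)
              (Eventually.of_forall (hHsq n i))
        _ ≤ _ := by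
            rw [integral_const_mul]
            gcongr
            exact hm.integral_looDensity_sub_sq_le hX hn (Finset.mem_range.1 hi)
    have key := integral_noise_sum_sq_le hX.measurable hem he hident hXe he2 he0
      (H := H n) (hHm n) (hHb n) (Finset.range n) hc
    have hL : MemLp (fun ω => ∑ i ∈ Finset.range n, H n i (fun j => X j ω) * e i ω) 2 P := by
      refine memLp_finsetSum _ fun i _ => ?_
      have hei : MemLp (e i) 2 P := (hident i).memLp_iff.2 he2
      refine (hei.const_mul (T * (2 / b + 1 / b))).mono
        (((hHm n i).comp (measurable_pi_lambda _ hX.measurable)).mul (hem i)).aestronglyMeasurable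
        (Eventually.of_forall fun ω => ?_)
      rw [norm_mul (H n i fun j => X j ω), norm_mul (T * (2 / b + 1 / b))]
      exact mul_le_mul_of_nonneg_right ((hHb n i fun j => X j ω).trans (le_abs_self _)) (norm_nonneg _)
    refine ⟨hL.integrable_sq.const_mul _, ?_⟩
    rw [integral_const_mul, inv_pow, Real.sq_sqrt hn0'.le, inv_mul_le_iff₀ hn0']
    rw [← mul_pow T]
    simpa [H] using key
  · simpa using (hVt.const_mul ((T * (2 / b ^ 2)) ^ 2)).mul_const (∫ ω, e 0 ω ^ 2 ∂P)

/-- The quadratic remainder of the linearization of the inverse density is negligible. -/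
lemma SmoothingModel.tendstoInMeasure_linearization (hm : SmoothingModel r K f C M B)
    (hX : IsSampleFrom P X f) (hb : 0 < b) (hpos : ∀ᶠ n in atTop, 0 < h n)
    (hs : Tendsto (fun n : ℕ => √(n : ℝ) * h n ^ r) atTop (𝓝 0))
    (hl : Tendsto (fun n : ℕ => √(n : ℝ) * h n ^ d) atTop atTop)
    {φ : EuclideanSpace ℝ (Fin d) → ℝ} {Φ : ℝ} (hφ : IsBoundedWeight f b φ Φ) :
    TendstoInMeasure P (fun (n : ℕ) ω => (√(n : ℝ))⁻¹ * ∑ i ∈ Finset.range n,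
      φ (X i ω) * ((max (looDensity K (h n) n (fun j => X j ω) i (X i ω)) (b / 2))⁻¹
        - (2 / f (X i ω) - looDensity K (h n) n (fun j => X j ω) i (X i ω) / f (X i ω) ^ 2)))
      atTop 0 := by
  have hΦ0 : 0 ≤ Φ := (abs_nonneg _).trans (hφ.bdd 0)
  set V := mseBound d r (C * (∫ v, |K v|) * M) ((∫ v, |K v|) * M) B h with hV
  have hVt : Tendsto (fun n : ℕ => √(n : ℝ) * V n) atTop (𝓝 0) :=
    tendsto_sqrt_mul_mseBound _ _ _ hs hl
  let R : ℕ → ℕ → Ω → ℝ := fun n i ω =>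
    φ (X i ω) * ((max (looDensity K (h n) n (fun j => X j ω) i (X i ω)) (b / 2))⁻¹
        - (2 / f (X i ω) - looDensity K (h n) n (fun j => X j ω) i (X i ω) / f (X i ω) ^ 2))
  have hRm : ∀ n i, Measurable (R n i) := by
    intro n i
    have h1 := hX.measurable_looDensity hm.kernel.measurable (h n) n i
    have h2 : Measurable fun ω => f (X i ω) := hm.measurable.comp (hX.measurable i)
    exact (hφ.measurable.comp (hX.measurable i)).mul ((h1.max measurable_const).inv.sub
      ((measurable_const.div h2).sub (h1.div (h2.pow_const 2))))
  have hRb : ∀ n i ω, |R n i ω| ≤ Φ * (4 / b ^ 3)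
      * (looDensity K (h n) n (fun j => X j ω) i (X i ω) - f (X i ω)) ^ 2 := by
    intro n i ω
    by_cases h0 : φ (X i ω) = 0
    · simp only [R, h0, zero_mul, abs_zero]; positivity
    · rw [abs_mul, mul_assoc]
      exact mul_le_mul (hφ.bdd _) (abs_inv_max_sub_taylor_le hb (hφ.support _ h0))
        (abs_nonneg _) hΦ0
  have hint : ∀ n i, Integrable (fun ω => Φ * (4 / b ^ 3)
      * (looDensity K (h n) n (fun j => X j ω) i (X i ω) - f (X i ω)) ^ 2) P :=
    fun n i => (hm.integrable_looDensity_sub_sq hX _ _ _).const_mul _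
  have hRint : ∀ n i, Integrable (R n i) P := fun n i =>
    (hint n i).mono' (hRm n i).aestronglyMeasurable (Eventually.of_forall (hRb n i))
  -- The summands are already quadratic in the density error, so first moments suffice: `n` of them
  -- divided by `√n` cost `√n` times the mean square error.
  refine tendstoInMeasure_zero_of_moment (k := 1)
    (a := fun n => Φ * (4 / b ^ 3) * (√(n : ℝ) * V n)) ?_ ?_
  · filter_upwards [hpos, eventually_gt_atTop 0] with n hn hn0
    have hn0' : (0 : ℝ) < n := by exact_mod_cast hn0
    simp_rw [pow_one]
    refine ⟨((integrable_finsetSum _ fun i _ => hRint n i).const_mul _).abs, ?_⟩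
    calc _ ≤ ∫ ω, (√(n : ℝ))⁻¹ * ∑ i ∈ Finset.range n, Φ * (4 / b ^ 3)
          * (looDensity K (h n) n (fun j => X j ω) i (X i ω) - f (X i ω)) ^ 2 ∂P := by
          refine integral_mono_of_nonneg (Eventually.of_forall fun ω => abs_nonneg _)
            ((integrable_finsetSum _ fun i _ => hint n i).const_mul _)
            (Eventually.of_forall fun ω => ?_)
          dsimp only
          rw [abs_mul, abs_of_nonneg (by positivity : 0 ≤ (√(n : ℝ))⁻¹)]
          gcongr
          exact (Finset.abs_sum_le_sum_abs _ _).trans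
            (Finset.sum_le_sum fun i _ => hRb n i ω)
      _ ≤ (√(n : ℝ))⁻¹ * ∑ i ∈ Finset.range n, Φ * (4 / b ^ 3) * V n := by
          rw [integral_const_mul, integral_finsetSum _ fun i _ => hint n i]
          gcongr with i hi
          rw [integral_const_mul]
          gcongr
          exact hm.integral_looDensity_sub_sq_le hX hn (Finset.mem_range.1 hi)
      _ = _ := by
          rw [Finset.sum_const, Finset.card_range, nsmul_eq_mul]
          have h4 : (n : ℝ) = √(n : ℝ) * √(n : ℝ) := (Real.mul_self_sqrt (Nat.cast_nonneg n)).symm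
          have h5 : 0 < √(n : ℝ) := Real.sqrt_pos.2 hn0'
          nth_rewrite 2 [h4]
          field_simp
  · simpa using hVt.const_mul (Φ * (4 / b ^ 3))

end Estimator

/-! ### Hoeffding decomposition of a U-statistic of order two -/

section Hoeffding

/-- Among ordered pairs of distinct indices, each index occurs `card - 1` times in either slot; this
collects the projections of a U-statistic into single sums. -/
lemma Finset.sum_sum_erase_add {ι : Type*} [DecidableEq ι] (s : Finset ι) (α γ : ι → ℝ) :
    ∑ i ∈ s, ∑ j ∈ s.erase i, (α i + γ j)
      = ((s.card : ℝ) - 1) * (∑ i ∈ s, α i + ∑ i ∈ s, γ i) := by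
  have h : ∀ i ∈ s, ∑ j ∈ s.erase i, (α i + γ j)
      = ((s.card : ℝ) - 1) * α i + (∑ j ∈ s, γ j - γ i) := by
    intro i hi
    have hc : ((s.erase i).card : ℝ) = (s.card : ℝ) - 1 := by
      rw [Finset.card_erase_of_mem hi, Nat.cast_sub (Finset.card_pos.2 ⟨i, hi⟩), Nat.cast_one]
    rw [Finset.sum_add_distrib, Finset.sum_const, nsmul_eq_mul, hc,
      ← Finset.add_sum_erase s γ hi]
    ring
  rw [Finset.sum_congr rfl h, Finset.sum_add_distrib, Finset.sum_sub_distrib, Finset.sum_const,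
    nsmul_eq_mul, ← Finset.mul_sum]
  ring

variable {Ω : Type*} [MeasurableSpace Ω] {P : Measure Ω} [IsProbabilityMeasure P]
  {E : Type*} [MeasurableSpace E] {X : ℕ → Ω → E} {μ : Measure E} [IsProbabilityMeasure μ]

/-- Second moment of the degenerate part in the Hoeffding decomposition. -/
lemma integral_hoeffding_sq_le (hX : iIndepFun X P) (hXm : ∀ i, Measurable (X i))
    (hlaw : ∀ i, HasLaw (X i) μ P) {k : E → E → ℝ} (hk : Measurable (Function.uncurry k))
    {B : ℝ} (hB : ∀ x y, |k x y| ≤ B) {α γ : E → ℝ} (hα : Measurable α) (hγ : Measurable γ)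
    (hkα : ∀ x, ∫ y, k x y ∂μ = α x) (hkγ : ∀ y, ∫ x, k x y ∂μ = γ y) {D : ℝ}
    (hαD : ∀ x, |α x| ≤ D) (hγD : ∀ x, |γ x| ≤ D)
    {s : ℝ} (hs : ∀ x, ∫ y, k x y ^ 2 ∂μ ≤ s) (n : ℕ) :
    ∫ ω, (∑ p ∈ (Finset.range n).offDiag, (k (X p.1 ω) (X p.2 ω) - α (X p.1 ω) - γ (X p.2 ω)
        + ∫ x, α x ∂μ)) ^ 2 ∂P
      ≤ (Finset.range n).offDiag.card * (2 * (2 * s + 18 * D ^ 2)) := by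
  set m := ∫ x, α x ∂μ with hmdef
  have hmr : ∀ x, Measurable (k x) := fun x => hk.comp measurable_prodMk_left
  have hml : ∀ y, Measurable fun x => k x y := fun y => hk.comp measurable_prodMk_right
  have hmD : |m| ≤ D := by
    rw [hmdef, ← Real.norm_eq_abs]
    simpa using norm_integral_le_of_norm_le_const (μ := μ) (C := D) (f := α)
      (Eventually.of_forall hαD)
  -- By Fubini both projections have the mean of the kernel.
  have hγm : ∫ y, γ y ∂μ = m := by
    have := integral_integral_swap (μ := μ) (ν := μ) (f := k)
      (integrable_of_abs_le hk.aemeasurable fun p => hB _ _)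
    simp_rw [hkα, hkγ] at this
    rw [← this]
  have iα : Integrable α μ := integrable_of_abs_le hα.aemeasurable hαD
  have iγ : Integrable γ μ := integrable_of_abs_le hγ.aemeasurable hγD
  have ir : ∀ x, Integrable (k x) μ := fun x => integrable_of_abs_le (hmr x).aemeasurable (hB x)
  have il : ∀ y, Integrable (fun x => k x y) μ := fun y =>
    integrable_of_abs_le (hml y).aemeasurable fun x => hB x y
  have hηb : ∀ x y, |k x y - α x - γ y + m| ≤ B + 3 * D := by
    intro x y
    have := abs_le.1 (hB x y)
    have := abs_le.1 (hαD x)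
    have := abs_le.1 (hγD y)
    have := abs_le.1 hmD
    rw [abs_le]
    constructor <;> linarith
  have hηm : Measurable (Function.uncurry fun x y => k x y - α x - γ y + m) :=
    ((hk.sub (hα.comp measurable_fst)).sub (hγ.comp measurable_snd)).add_const m
  refine integral_degenerate_sum_sq_le hX hXm hlaw (ζ := fun x y => k x y - α x - γ y + m)
    hηm hηb ?_ ?_ ?_ n
  · intro x
    have i1 : Integrable (fun y => k x y - α x) μ := (ir x).sub (integrable_const _)
    have i2 : Integrable (fun y => k x y - α x - γ y) μ := i1.sub iγ
    rw [integral_add i2 (integrable_const _), integral_sub i1 iγ,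
      integral_sub (ir x) (integrable_const _), hkα, hγm]
    simp
  · intro y
    have i1 : Integrable (fun x => k x y - α x) μ := (il y).sub iα
    have i2 : Integrable (fun x => k x y - α x - γ y) μ := i1.sub (integrable_const _)
    rw [integral_add i2 (integrable_const _), integral_sub i1 (integrable_const _),
      integral_sub (il y) iα, hkγ, ← hmdef]
    simp
  · intro x
    have i1 : Integrable (fun y => k x y ^ 2) μ :=
      (memLp_of_abs_le (hmr x).aemeasurable (hB x)).integrable_sq
    -- Again `(a + b)² ≤ 2a² + 2b²`, with `|m - α x - γ y| ≤ 3 D`, whence `2 * (3 D)² = 18 D²`.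
    calc ∫ y, (k x y - α x - γ y + m) ^ 2 ∂μ ≤ ∫ y, (2 * k x y ^ 2 + 18 * D ^ 2) ∂μ := by
          refine integral_mono_of_nonneg (Eventually.of_forall fun y => sq_nonneg _)
            ((i1.const_mul _).add (integrable_const _)) (Eventually.of_forall fun y => ?_)
          have h1 : |m - α x - γ y| ≤ 3 * D := by
            have := abs_le.1 (hαD x)
            have := abs_le.1 (hγD y)
            have := abs_le.1 hmD
            rw [abs_le]
            constructor <;> linarith
          have h2 := sq_le_sq' (abs_le.1 h1).1 (abs_le.1 h1).2
          dsimp only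
          nlinarith [sq_nonneg (k x y - (m - α x - γ y))]
      _ = 2 * ∫ y, k x y ^ 2 ∂μ + 18 * D ^ 2 := by
          rw [integral_add (i1.const_mul _) (integrable_const _), integral_const_mul]
          simp
      _ ≤ _ := by linarith [hs x]

end Hoeffding

/-! ### The linearized estimator as a U-statistic -/

section Estimator

variable {d : ℕ} {r : ℕ} {K f : EuclideanSpace ℝ (Fin d) → ℝ} {C M B : ℝ}
  {Ω : Type*} [MeasurableSpace Ω] {P : Measure Ω} [IsProbabilityMeasure P]
  {X : ℕ → Ω → EuclideanSpace ℝ (Fin d)} {h : ℕ → ℝ} {b : ℝ}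
  {φ : EuclideanSpace ℝ (Fin d) → ℝ} {Φ : ℝ}

lemma IsBoundedWeight.abs_div_pow_le (hφ : IsBoundedWeight f b φ Φ) (hb : 0 < b) (k : ℕ)
    (x : EuclideanSpace ℝ (Fin d)) : |φ x / f x ^ k| ≤ Φ / b ^ k := by
  have hΦ0 : 0 ≤ Φ := (abs_nonneg _).trans (hφ.bdd 0)
  by_cases h0 : φ x = 0
  · rw [h0, zero_div, abs_zero]; positivity
  · have h1 := hφ.support x h0
    have h2 : 0 < f x := hb.trans_le h1
    rw [abs_div, abs_of_pos (pow_pos h2 k)]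
    gcongr
    exact hφ.bdd x

lemma IsBoundedWeight.div_mul_cancel (hφ : IsBoundedWeight f b φ Φ) (hb : 0 < b)
    (x : EuclideanSpace ℝ (Fin d)) : φ x / f x * f x = φ x := by
  by_cases h0 : φ x = 0
  · rw [h0]; simp
  · exact div_mul_cancel₀ _ (hb.trans_le (hφ.support x h0)).ne'

lemma IsBoundedWeight.div_sq_mul (hφ : IsBoundedWeight f b φ Φ) (hb : 0 < b)
    (x : EuclideanSpace ℝ (Fin d)) : φ x / f x ^ 2 * f x = φ x / f x := by
  by_cases h0 : φ x = 0
  · rw [h0]; simp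
  · have := (hb.trans_le (hφ.support x h0)).ne'
    field_simp

/-- The kernel of the U-statistic in the linearized estimator. -/
noncomputable def linearizedKernel (K f φ : EuclideanSpace ℝ (Fin d) → ℝ) (a : ℝ)
    (x y : EuclideanSpace ℝ (Fin d)) : ℝ :=
  φ x / f x ^ 2 * ((a ^ d)⁻¹ * K (a⁻¹ • (y - x)))

lemma SmoothingModel.integral_linearizedKernel_right (hm : SmoothingModel r K f C M B)
    (φ : EuclideanSpace ℝ (Fin d) → ℝ) {a : ℝ} (ha : 0 < a) (x : EuclideanSpace ℝ (Fin d)) :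
    ∫ y, linearizedKernel K f φ a x y ∂(densityMeasure f)
      = φ x / f x ^ 2 * kernelSmooth K a f x := by
  unfold linearizedKernel
  rw [integral_const_mul, integral_const_mul,
    integral_scaled_kernel_densityMeasure hm.measurable hm.nonneg ha]
  have : a ^ d ≠ 0 := by positivity
  field_simp

/-- Symmetry of `K` lets the kernel be centered at `y`, and integrating against the density cancels
one of the two factors `f` in the denominator. Thus this projection, like the other one,
approximates `φ / f`. -/
lemma SmoothingModel.integral_linearizedKernel_left (hm : SmoothingModel r K f C M B)
    (hb : 0 < b) (hφ : IsBoundedWeight f b φ Φ) {a : ℝ} (ha : 0 < a)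
    (y : EuclideanSpace ℝ (Fin d)) :
    ∫ x, linearizedKernel K f φ a x y ∂(densityMeasure f)
      = kernelSmooth K a (fun x => φ x / f x) y := by
  rw [integral_densityMeasure hm.measurable hm.nonneg]
  have e : ∀ x, linearizedKernel K f φ a x y * f x
      = (a ^ d)⁻¹ * (K (a⁻¹ • (x - y)) * (φ x / f x)) := by
    intro x
    rw [linearizedKernel, ← hφ.div_sq_mul hb x, ← hm.kernel.symmetric (a⁻¹ • (y - x)), ← smul_neg,
      neg_sub]
    ring
  simp_rw [e]
  rw [integral_const_mul, integral_scaled_kernel_mul K (fun x => φ x / f x) ha]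
  have : a ^ d ≠ 0 := by positivity
  field_simp

/-- An identity for arbitrary `α`, `γ`, `m`, `I`. With the projections, their common mean and `I = ∫
φ`, its three terms are a degenerate U-statistic, a centered i.i.d. sum and a deterministic bias.
The factor `1 - 1 / n` comes from `n (n - 1)` pairs normalized by `n²`. -/
lemma sum_sub_looDensity_eq_hoeffding (K f φ : EuclideanSpace ℝ (Fin d) → ℝ) {a : ℝ}
    (ha : 0 < a) {n : ℕ} (hn : 0 < n) (x : ℕ → EuclideanSpace ℝ (Fin d))
    (α γ : EuclideanSpace ℝ (Fin d) → ℝ) (m I : ℝ) :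
    (√(n : ℝ))⁻¹ * (∑ i ∈ Finset.range n,
      φ (x i) * (2 / f (x i) - looDensity K a n x i (x i) / f (x i) ^ 2)) - √(n : ℝ) * I
    = -((√(n : ℝ))⁻¹ * (n : ℝ)⁻¹ * ∑ p ∈ (Finset.range n).offDiag,
          (linearizedKernel K f φ a (x p.1) (x p.2) - α (x p.1) - γ (x p.2) + m))
      + (√(n : ℝ))⁻¹ * (∑ i ∈ Finset.range n, ((2 * (φ (x i) / f (x i))
          - (1 - (n : ℝ)⁻¹) * (α (x i) + γ (x i))) - (2 * I - 2 * ((1 - (n : ℝ)⁻¹) * m))))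
      + √(n : ℝ) * (I - (1 - (n : ℝ)⁻¹) * m) := by
  have hn' : (0 : ℝ) < n := by exact_mod_cast hn
  have had : a ^ d ≠ 0 := by positivity
  set S := ∑ i ∈ Finset.range n, ∑ j ∈ (Finset.range n).erase i,
    linearizedKernel K f φ a (x i) (x j) with hS
  have h1 : ∑ i ∈ Finset.range n,
      φ (x i) * (2 / f (x i) - looDensity K a n x i (x i) / f (x i) ^ 2)
      = 2 * ∑ i ∈ Finset.range n, φ (x i) / f (x i) - (n : ℝ)⁻¹ * S := by
    rw [hS, Finset.mul_sum, Finset.mul_sum, ← Finset.sum_sub_distrib]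
    refine Finset.sum_congr rfl fun i _ => ?_
    unfold linearizedKernel looDensity
    rw [← Finset.mul_sum, ← Finset.mul_sum, mul_inv]
    ring
  have h2 : ∑ p ∈ (Finset.range n).offDiag,
      (linearizedKernel K f φ a (x p.1) (x p.2) - α (x p.1) - γ (x p.2) + m)
      = S - ((n : ℝ) - 1) * (∑ i ∈ Finset.range n, (α (x i) + γ (x i)))
        + n * ((n : ℝ) - 1) * m := by
    rw [Finset.sum_offDiag_eq_sum_erase (Finset.range n)
      (fun i j => linearizedKernel K f φ a (x i) (x j) - α (x i) - γ (x j) + m)]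
    have e := Finset.sum_sum_erase_add (Finset.range n) (fun i => α (x i) - m)
      (fun i => γ (x i))
    have e2 : ∀ i j, linearizedKernel K f φ a (x i) (x j) - α (x i) - γ (x j) + m
        = linearizedKernel K f φ a (x i) (x j) - ((α (x i) - m) + γ (x j)) := fun i j => by ring
    simp_rw [e2, Finset.sum_sub_distrib, Finset.sum_add_distrib] at e ⊢
    rw [e, ← hS]
    simp only [Finset.card_range, Finset.sum_const, nsmul_eq_mul]
    ring
  rw [h1, h2]
  simp only [Finset.sum_sub_distrib, Finset.sum_const, Finset.card_range, nsmul_eq_mul,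
    ← Finset.mul_sum]
  set S1 := ∑ i ∈ Finset.range n, φ (x i) / f (x i)
  set S2 := ∑ i ∈ Finset.range n, (α (x i) + γ (x i))
  obtain ⟨q, hq, hqn⟩ : ∃ q : ℝ, 0 < q ∧ (n : ℝ) = q ^ 2 :=
    ⟨√(n : ℝ), Real.sqrt_pos.2 hn', (Real.sq_sqrt hn'.le).symm⟩
  rw [hqn, Real.sqrt_sq hq.le]
  field_simp
  ring

end Estimator

/-! ### Negligibility of the linearized part -/

section Estimator

variable {d : ℕ} {r : ℕ} {K f : EuclideanSpace ℝ (Fin d) → ℝ} {C M B : ℝ}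
  {Ω : Type*} [MeasurableSpace Ω] {P : Measure Ω} [IsProbabilityMeasure P]
  {X : ℕ → Ω → EuclideanSpace ℝ (Fin d)} {h : ℕ → ℝ} {b : ℝ}
  {φ : EuclideanSpace ℝ (Fin d) → ℝ} {Φ : ℝ}

lemma tendstoInMeasure_zero_of_tendsto {c : ℕ → ℝ} (hc : Tendsto c atTop (𝓝 0)) :
    TendstoInMeasure P (fun n _ => c n) atTop 0 :=
  tendstoInMeasure_zero_of_moment (k := 1) (a := fun n => |c n|)
    (Eventually.of_forall fun n => ⟨by simp, by simp⟩) (by simpa using hc.abs)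

/-- The linearized integral estimator converges faster than the root-`n` rate. -/
lemma SmoothingModel.tendstoInMeasure_linear (hm : SmoothingModel r K f C M B)
    (hX : IsSampleFrom P X f) (hb : 0 < b) (hpos : ∀ᶠ n in atTop, 0 < h n)
    (hs : Tendsto (fun n : ℕ => √(n : ℝ) * h n ^ r) atTop (𝓝 0))
    (hl : Tendsto (fun n : ℕ => √(n : ℝ) * h n ^ d) atTop atTop)
    (hφ : IsBoundedWeight f b φ Φ)
    (hcont : ∀ᵐ x ∂(densityMeasure f), ContinuousAt (fun x => φ x / f x) x) :
    TendstoInMeasure P (fun (n : ℕ) ω => (√(n : ℝ))⁻¹ * (∑ i ∈ Finset.range n,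
      φ (X i ω) * (2 / f (X i ω)
        - looDensity K (h n) n (fun j => X j ω) i (X i ω) / f (X i ω) ^ 2))
      - √(n : ℝ) * ∫ x, φ x) atTop 0 := by
  have := hX.isProbabilityMeasure
  have hΦ0 : 0 ≤ Φ := (abs_nonneg _).trans (hφ.bdd 0)
  have hC0 : 0 ≤ C := (abs_nonneg _).trans (hm.kernel_le 0)
  have hA0 : 0 ≤ ∫ v, |K v| := integral_nonneg fun v => abs_nonneg _
  have hM0 : 0 ≤ M := (hm.nonneg 0).trans (hm.density_le 0)
  set μ := densityMeasure f with hμ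
  let u : EuclideanSpace ℝ (Fin d) → ℝ := fun x => φ x / f x
  let α : ℕ → EuclideanSpace ℝ (Fin d) → ℝ :=
    fun n x => φ x / f x ^ 2 * kernelSmooth K (h n) f x
  let γ : ℕ → EuclideanSpace ℝ (Fin d) → ℝ := fun n => kernelSmooth K (h n) u
  let m : ℕ → ℝ := fun n => ∫ x, α n x ∂μ
  -- One summand bounds `α`, the other bounds `γ`; neither depends on `n`.
  set D := Φ / b ^ 2 * ((∫ v, |K v|) * M) + (∫ v, |K v|) * (Φ / b) with hD
  set s := C * (∫ v, |K v|) * M with hsdef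
  have hum : Measurable u := hφ.measurable.div hm.measurable
  have hub : ∀ x, |u x| ≤ Φ / b := fun x => by simpa [u] using hφ.abs_div_pow_le hb 1 x
  have hwm : Measurable fun x => φ x / f x ^ 2 := hφ.measurable.div (hm.measurable.pow_const 2)
  have hαm : ∀ n, Measurable (α n) := fun n =>
    hwm.mul (measurable_kernelSmooth hm.kernel.measurable hm.measurable _)
  have hγm : ∀ n, Measurable (γ n) := fun n =>
    measurable_kernelSmooth hm.kernel.measurable hum _
  have hαD : ∀ n x, |α n x| ≤ D := by
    intro n x
    have h1 : |α n x| ≤ Φ / b ^ 2 * ((∫ v, |K v|) * M) := by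
      rw [abs_mul]
      exact mul_le_mul (hφ.abs_div_pow_le hb 2 x)
        (hm.kernel.abs_kernelSmooth_le hm.abs_density_le _ _) (abs_nonneg _) (by positivity)
    have : 0 ≤ (∫ v, |K v|) * (Φ / b) := by positivity
    linarith
  have hγD : ∀ n x, |γ n x| ≤ D := by
    intro n x
    have h1 : |γ n x| ≤ (∫ v, |K v|) * (Φ / b) := hm.kernel.abs_kernelSmooth_le hub _ _
    have : 0 ≤ Φ / b ^ 2 * ((∫ v, |K v|) * M) := by positivity
    linarith
  have iu : Integrable u μ := integrable_of_abs_le hum.aemeasurable hub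
  have iα : ∀ n, Integrable (α n) μ := fun n =>
    integrable_of_abs_le (hαm n).aemeasurable (hαD n)
  have iγ : ∀ n, Integrable (γ n) μ := fun n =>
    integrable_of_abs_le (hγm n).aemeasurable (hγD n)
  have hI : ∫ x, φ x = ∫ x, u x ∂μ := by
    rw [hμ, integral_densityMeasure hm.measurable hm.nonneg]
    simp_rw [u, hφ.div_mul_cancel hb]
  have huα : ∀ n, 0 < h n → ∀ x, |u x - α n x| ≤ Φ / b ^ 2 * B * h n ^ r := by
    intro n hn x
    have e : u x - α n x = -(φ x / f x ^ 2 * (kernelSmooth K (h n) f x - f x)) := by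
      simp only [u, α]
      rw [← hφ.div_sq_mul hb x]
      ring
    rw [e, abs_neg, abs_mul, mul_assoc]
    exact mul_le_mul (hφ.abs_div_pow_le hb 2 x) (hm.bias_le _ hn x) (abs_nonneg _) (by positivity)
  have hkm : ∀ a, Measurable (Function.uncurry (linearizedKernel K f φ a)) := fun a =>
    (hwm.comp measurable_fst).mul ((measurable_scaled_kernel hm.kernel.measurable a).const_mul _)
  have hkb : ∀ a, 0 < a → ∀ x y, |linearizedKernel K f φ a x y|
      ≤ Φ / b ^ 2 * ((a ^ d)⁻¹ * C) := by
    intro a ha x y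
    rw [linearizedKernel, abs_mul, abs_mul, abs_of_pos (by positivity : 0 < (a ^ d)⁻¹)]
    have h1 := hφ.abs_div_pow_le hb 2 x
    have h2 := hm.kernel_le (a⁻¹ • (y - x))
    gcongr
  have hksq : ∀ a, 0 < a → ∀ x, ∫ y, linearizedKernel K f φ a x y ^ 2 ∂μ
      ≤ (Φ / b ^ 2) ^ 2 * (s / a ^ d) := by
    intro a ha x
    have e : ∀ y, linearizedKernel K f φ a x y ^ 2
        = ((φ x / f x ^ 2) ^ 2 * ((a ^ d)⁻¹) ^ 2) * K (a⁻¹ • (y - x)) ^ 2 := fun y => by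
      rw [linearizedKernel]; ring
    simp_rw [e]
    rw [integral_const_mul]
    have h1 : (φ x / f x ^ 2) ^ 2 ≤ (Φ / b ^ 2) ^ 2 := by
      have := abs_le.1 (hφ.abs_div_pow_le hb 2 x)
      exact sq_le_sq' this.1 this.2
    have h2 := hm.kernel.integral_scaled_sq_le hm.measurable hm.nonneg hm.kernel_le
      hm.density_le ha x
    calc _ ≤ ((Φ / b ^ 2) ^ 2 * ((a ^ d)⁻¹) ^ 2) * (a ^ d * s) := by gcongr
      _ = _ := by field_simp
  -- Degenerate part: about `n²` pairs with kernel second moment of order `1 / h^d`, scaled by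
  -- `n⁻³`. Below, `mseBound` with both bias constants zero is just `2 s / (n h^d)`.
  have t1 : TendstoInMeasure P (fun (n : ℕ) ω => -((√(n : ℝ))⁻¹ * (n : ℝ)⁻¹ *
      ∑ p ∈ (Finset.range n).offDiag, (linearizedKernel K f φ (h n) (X p.1 ω) (X p.2 ω)
        - α n (X p.1 ω) - γ n (X p.2 ω) + m n))) atTop 0 := by
    have hV : Tendsto (fun n : ℕ => 2 * (Φ / b ^ 2) ^ 2 * mseBound d r s 0 0 h n
        + 36 * D ^ 2 / n) atTop (𝓝 0) := by
      have h1 := (tendsto_mseBound (d := d) (r := r) hm.const_nonneg 0 0 hpos hs hl).const_mul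
        (2 * (Φ / b ^ 2) ^ 2)
      have h2 := h1.add (tendsto_const_div_atTop_nhds_zero_nat (36 * D ^ 2))
      rw [mul_zero, add_zero] at h2
      exact h2
    refine tendstoInMeasure_zero_of_moment (k := 2) ?_ hV
    filter_upwards [hpos, eventually_gt_atTop 0] with n hn hn0
    have hn0' : (0 : ℝ) < n := by exact_mod_cast hn0
    have key := integral_hoeffding_sq_le hX.indep hX.measurable hX.law (hkm (h n))
      (hkb _ hn) (hαm n) (hγm n) (hm.integral_linearizedKernel_right φ hn)
      (hm.integral_linearizedKernel_left hb hφ hn) (hαD n) (hγD n) (hksq _ hn) n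
    have hZm : ∀ p : ℕ × ℕ, Measurable fun ω => linearizedKernel K f φ (h n) (X p.1 ω) (X p.2 ω)
        - α n (X p.1 ω) - γ n (X p.2 ω) + m n := fun p =>
      ((((hkm (h n)).comp ((hX.measurable p.1).prodMk (hX.measurable p.2))).sub
        ((hαm n).comp (hX.measurable p.1))).sub ((hγm n).comp (hX.measurable p.2))).add_const _
    have hint : Integrable (fun ω => (∑ p ∈ (Finset.range n).offDiag,
        (linearizedKernel K f φ (h n) (X p.1 ω) (X p.2 ω)
        - α n (X p.1 ω) - γ n (X p.2 ω) + m n)) ^ 2) P := by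
      refine MemLp.integrable_sq (memLp_finsetSum _ fun p _ => memLp_of_abs_le
        (B := Φ / b ^ 2 * ((h n ^ d)⁻¹ * C) + D + D + |m n|) (hZm p).aemeasurable fun ω => ?_)
      have h1 := hkb _ hn (X p.1 ω) (X p.2 ω)
      have h2 := hαD n (X p.1 ω)
      have h3 := hγD n (X p.2 ω)
      exact (abs_add_le _ _).trans (add_le_add ((abs_sub _ _).trans
        (add_le_add ((abs_sub _ _).trans (add_le_add h1 h2)) h3)) le_rfl)
    simp_rw [sq_abs, neg_sq, mul_pow _ (∑ _ ∈ _, _)]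
    refine ⟨hint.const_mul _, ?_⟩
    rw [integral_const_mul]
    have hcard : (((Finset.range n).offDiag.card : ℕ) : ℝ) ≤ (n : ℝ) ^ 2 := by
      rw [Finset.offDiag_card, Finset.card_range, sq]
      exact_mod_cast Nat.sub_le _ _
    have hsn : 0 ≤ s := hm.const_nonneg
    have hhd : 0 < h n ^ d := by positivity
    calc _ ≤ ((√(n : ℝ))⁻¹ * (n : ℝ)⁻¹) ^ 2
          * ((n : ℝ) ^ 2 * (2 * (2 * ((Φ / b ^ 2) ^ 2 * (s / h n ^ d)) + 18 * D ^ 2))) := by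
          refine mul_le_mul_of_nonneg_left (key.trans ?_) (sq_nonneg _)
          gcongr
      _ = _ := by
          rw [mul_pow, inv_pow, Real.sq_sqrt hn0'.le, mseBound]
          field_simp
          ring
  -- Projection part: after centering and root-`n` scaling only the variance matters, so the mean
  -- square convergence of `γ n` to `u` needs no rate.
  have t2 : TendstoInMeasure P (fun (n : ℕ) ω => (√(n : ℝ))⁻¹ * (∑ i ∈ Finset.range n,
      ((2 * (φ (X i ω) / f (X i ω)) - (1 - (n : ℝ)⁻¹) * (α n (X i ω) + γ n (X i ω)))
        - (2 * (∫ x, φ x) - 2 * ((1 - (n : ℝ)⁻¹) * m n))))) atTop 0 := by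
    have hV : Tendsto (fun n : ℕ => 3 * (Φ / b ^ 2 * B * h n ^ r) ^ 2
        + 3 * (∫ x, (u x - γ n x) ^ 2 ∂μ) + 12 * D ^ 2 * ((n : ℝ)⁻¹) ^ 2) atTop (𝓝 0) := by
      have h1 := (((tendsto_bandwidth_pow hs).const_mul (Φ / b ^ 2 * B)).pow 2).const_mul 3
      have h2 := (tendsto_integral_sub_kernelSmooth_sq hm.kernel hum hub hcont
        (tendsto_bandwidth hpos hs)).const_mul 3
      have h3 := ((tendsto_inv_atTop_nhds_zero_nat (𝕜 := ℝ)).pow 2).const_mul (12 * D ^ 2)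
      have h4 := (h1.add h2).add h3
      simp only [mul_zero, ne_eq, OfNat.ofNat_ne_zero, not_false_eq_true, zero_pow,
        add_zero] at h4
      exact h4
    refine tendstoInMeasure_zero_of_moment (k := 2) ?_ hV
    filter_upwards [hpos, eventually_gt_atTop 0] with n hn hn0
    have hn0' : (0 : ℝ) < n := by exact_mod_cast hn0
    let ρ : EuclideanSpace ℝ (Fin d) → ℝ := fun x =>
      2 * u x - (1 - (n : ℝ)⁻¹) * (α n x + γ n x)
    have hρm : Measurable ρ := (hum.const_mul 2).sub (((hαm n).add (hγm n)).const_mul _)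
    have hmγ : ∫ y, γ n y ∂μ = m n := by
      have := integral_integral_swap (μ := μ) (ν := μ) (f := linearizedKernel K f φ (h n))
        (integrable_of_abs_le (hkm _).aemeasurable fun p => hkb _ hn _ _)
      simp_rw [hμ, hm.integral_linearizedKernel_right φ hn,
        hm.integral_linearizedKernel_left hb hφ hn] at this
      exact this.symm
    have hρi : Integrable ρ μ := (iu.const_mul 2).sub (((iα n).add (iγ n)).const_mul _)
    have hρint : ∫ x, ρ x ∂μ = 2 * (∫ x, φ x) - 2 * ((1 - (n : ℝ)⁻¹) * m n) := by
      have e1 : ∫ x, (α n x + γ n x) ∂μ = m n + m n := by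
        rw [integral_add (iα n) (iγ n), hmγ]
      have i1 : Integrable (fun x => α n x + γ n x) μ := (iα n).add (iγ n)
      rw [integral_sub (iu.const_mul 2) (i1.const_mul _), integral_const_mul,
        integral_const_mul, e1, hI]
      ring
    set c := 2 * (∫ x, φ x) - 2 * ((1 - (n : ℝ)⁻¹) * m n) with hc
    have hn1 : |1 - (n : ℝ)⁻¹| ≤ 1 := by
      have h1 : (n : ℝ)⁻¹ ≤ 1 := inv_le_one_of_one_le₀ (by exact_mod_cast hn0)
      have h2 : 0 < (n : ℝ)⁻¹ := by positivity
      rw [abs_le]; constructor <;> linarith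
    have hρb : ∀ x, |ρ x - c| ≤ 2 * (Φ / b) + 1 * (D + D) + |c| := by
      intro x
      refine (abs_sub _ _).trans (add_le_add ((abs_sub _ _).trans (add_le_add ?_ ?_)) le_rfl)
      · rw [abs_mul, abs_two]; gcongr; exact hub x
      · rw [abs_mul]
        exact mul_le_mul hn1 ((abs_add_le _ _).trans (add_le_add (hαD n x) (hγD n x)))
          (abs_nonneg _) zero_le_one
    have key := integral_sum_range_sq_le hX.indep hX.measurable hX.law (ρ := fun x => ρ x - c)
      (hρm.sub_const c) hρb
      (by rw [integral_sub hρi (integrable_const _), hρint]; simp [hc]) n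
    have hvar : ∫ x, (ρ x - c) ^ 2 ∂μ ≤ ∫ x, ρ x ^ 2 ∂μ := by
      have i2 : Integrable (fun x => (ρ x - c) ^ 2) μ :=
        (memLp_of_abs_le (hρm.sub_const c).aemeasurable hρb).integrable_sq
      have e : ∀ x, ρ x ^ 2 = (ρ x - c) ^ 2 + (2 * c * ρ x - c ^ 2) := fun x => by ring
      simp_rw [e]
      have i3 : Integrable (fun x => 2 * c * ρ x - c ^ 2) μ :=
        (hρi.const_mul _).sub (integrable_const _)
      rw [integral_add i2 i3, integral_sub (hρi.const_mul _) (integrable_const _),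
        integral_const_mul, hρint]
      simp only [integral_const, probReal_univ, one_smul]
      nlinarith [sq_nonneg c]
    have iuγ : Integrable (fun x => (u x - γ n x) ^ 2) μ :=
      (memLp_of_abs_le (hum.sub (hγm n)).aemeasurable fun x =>
        (abs_sub _ _).trans (add_le_add (hub x) (hγD n x))).integrable_sq
    have hρ2 : ∫ x, ρ x ^ 2 ∂μ ≤ 3 * (Φ / b ^ 2 * B * h n ^ r) ^ 2
        + 3 * (∫ x, (u x - γ n x) ^ 2 ∂μ) + 12 * D ^ 2 * ((n : ℝ)⁻¹) ^ 2 := by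
      have i1 : Integrable (fun x => 3 * (Φ / b ^ 2 * B * h n ^ r) ^ 2
          + 3 * (u x - γ n x) ^ 2) μ := (integrable_const _).add (iuγ.const_mul 3)
      calc _ ≤ ∫ x, (3 * (Φ / b ^ 2 * B * h n ^ r) ^ 2 + 3 * (u x - γ n x) ^ 2
            + 12 * D ^ 2 * ((n : ℝ)⁻¹) ^ 2) ∂μ := by
            refine integral_mono_of_nonneg (Eventually.of_forall fun x => sq_nonneg _)
              (i1.add (integrable_const _)) (Eventually.of_forall fun x => ?_)
            -- Each projection cancels one copy of `u`, up to the `1 / n` correction.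
            have e : ρ x = (u x - α n x) + (u x - γ n x) + (n : ℝ)⁻¹ * (α n x + γ n x) := by
              simp only [ρ]; ring
            have h1 := abs_le.1 (huα n hn x)
            have h1' := sq_le_sq' h1.1 h1.2
            have h2 := abs_le.1 ((abs_add_le _ _).trans (add_le_add (hαD n x) (hγD n x)))
            have h2' := mul_le_mul_of_nonneg_left (sq_le_sq' h2.1 h2.2) (sq_nonneg ((n : ℝ)⁻¹))
            have h3 : ∀ p q t : ℝ, (p + q + t) ^ 2 ≤ 3 * p ^ 2 + 3 * q ^ 2 + 3 * t ^ 2 := by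
              intro p q t
              nlinarith [sq_nonneg (p - q), sq_nonneg (q - t), sq_nonneg (p - t)]
            dsimp only
            rw [e]
            refine (h3 _ _ _).trans ?_
            rw [mul_pow]
            linarith
        _ = _ := by
            rw [integral_add i1 (integrable_const _),
              integral_add (integrable_const _) (iuγ.const_mul 3)]
            simp [integral_const_mul]
    have hint : Integrable (fun ω => (∑ i ∈ Finset.range n, (ρ (X i ω) - c)) ^ 2) P :=
      MemLp.integrable_sq (memLp_finsetSum _ fun i _ => memLp_of_abs_le
        ((hρm.sub_const c).comp (hX.measurable i)).aemeasurable fun ω => hρb _)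
    simp_rw [sq_abs, mul_pow _ (∑ _ ∈ _, _)]
    refine ⟨hint.const_mul _, ?_⟩
    rw [integral_const_mul, inv_pow, Real.sq_sqrt hn0'.le, inv_mul_le_iff₀ hn0']
    exact key.trans (by gcongr; exact hvar.trans hρ2)
  -- Bias part: a rate is needed here. Writing the common mean through `α n` gives `h ^ r` from the
  -- smoothness of `f`; through `γ n` it would call for smoothness of `u`.
  have t3 : Tendsto (fun n : ℕ => √(n : ℝ) * ((∫ x, φ x) - (1 - (n : ℝ)⁻¹) * m n)) atTop
      (𝓝 0) := by
    have hV : Tendsto (fun n : ℕ => Φ / b ^ 2 * B * (√(n : ℝ) * h n ^ r) + (√(n : ℝ))⁻¹ * D)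
        atTop (𝓝 0) := by
      have := (hs.const_mul (Φ / b ^ 2 * B)).add (tendsto_inv_sqrt_natCast.mul_const D)
      simpa using this
    refine squeeze_zero_norm' ?_ hV
    filter_upwards [hpos, eventually_gt_atTop 0] with n hn hn0
    have hn0' : (0 : ℝ) < n := by exact_mod_cast hn0
    have hIm : |(∫ x, φ x) - m n| ≤ Φ / b ^ 2 * B * h n ^ r := by
      rw [hI, ← integral_sub iu (iα n), ← Real.norm_eq_abs]
      simpa using norm_integral_le_of_norm_le_const (μ := μ)
        (C := Φ / b ^ 2 * B * h n ^ r) (f := fun x => u x - α n x)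
        (Eventually.of_forall (huα n hn))
    have hmD : |m n| ≤ D := by
      rw [← Real.norm_eq_abs]
      simpa using norm_integral_le_of_norm_le_const (μ := μ) (C := D) (f := α n)
        (Eventually.of_forall (hαD n))
    have h4 : (n : ℝ)⁻¹ = (√(n : ℝ))⁻¹ * (√(n : ℝ))⁻¹ := by
      rw [← mul_inv, Real.mul_self_sqrt hn0'.le]
    have h5 : 0 < √(n : ℝ) := Real.sqrt_pos.2 hn0'
    have e : √(n : ℝ) * ((∫ x, φ x) - (1 - (n : ℝ)⁻¹) * m n)
        = √(n : ℝ) * ((∫ x, φ x) - m n) + (√(n : ℝ))⁻¹ * m n := by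
      rw [h4]; field_simp; ring
    rw [e, Real.norm_eq_abs]
    refine (abs_add_le _ _).trans (add_le_add ?_ ?_)
    · rw [abs_mul, abs_of_pos h5]
      calc _ ≤ √(n : ℝ) * (Φ / b ^ 2 * B * h n ^ r) := by gcongr
        _ = _ := by ring
    · rw [abs_mul, abs_of_pos (inv_pos.2 h5)]
      gcongr
  refine ((t1.add_zero_real t2).add_zero_real
    (tendstoInMeasure_zero_of_tendsto t3)).congr' ?_ EventuallyEq.rfl
  filter_upwards [hpos, eventually_gt_atTop 0] with n hn hn0
  refine Eventually.of_forall fun ω => ?_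
  exact (sum_sub_looDensity_eq_hoeffding K f φ hn hn0 (fun j => X j ω) (α n) (γ n) (m n) _).symm

end Estimator

/-! ### Independence of the pairs of design point and noise -/

section Pairs

/-- Two independent sequences of independent variables give independent pairs. -/
lemma ProbabilityTheory.iIndepFun.prodMk_of_indepFun {Ω E F : Type*} [MeasurableSpace Ω]
    [MeasurableSpace E] [MeasurableSpace F] {P : Measure Ω} [IsProbabilityMeasure P]
    {X : ℕ → Ω → E} {e : ℕ → Ω → F} (hX : iIndepFun X P) (he : iIndepFun e P)
    (hXm : ∀ i, Measurable (X i)) (hem : ∀ i, Measurable (e i))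
    (hXe : IndepFun (fun ω i => X i ω) (fun ω i => e i ω) P) :
    iIndepFun (fun i ω => (X i ω, e i ω)) P := by
  have pX : ∀ i, IsProbabilityMeasure (P.map (X i)) := fun i =>
    Measure.isProbabilityMeasure_map (hXm i).aemeasurable
  have pe : ∀ i, IsProbabilityMeasure (P.map (e i)) := fun i =>
    Measure.isProbabilityMeasure_map (hem i).aemeasurable
  have hpair : ∀ i, P.map (fun ω => (X i ω, e i ω)) = (P.map (X i)).prod (P.map (e i)) :=
    fun i => (indepFun_iff_map_prod_eq_prod_map_map (hXm i).aemeasurable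
      (hem i).aemeasurable).1 (hXe.comp (measurable_pi_apply i) (measurable_pi_apply i))
  rw [iIndepFun_iff_finset]
  intro s
  have hXs : iIndepFun (s.restrict X) P := iIndepFun_iff_finset.1 hX s
  have hes : iIndepFun (s.restrict e) P := iIndepFun_iff_finset.1 he s
  have hXs' := (iIndepFun_iff_map_fun_eq_pi_map (f := s.restrict X)
    fun i => (hXm i).aemeasurable).1 hXs
  have hes' := (iIndepFun_iff_map_fun_eq_pi_map (f := s.restrict e)
    fun i => (hem i).aemeasurable).1 hes
  have hXem : Measurable fun ω => (fun i : s => X i ω) := measurable_pi_lambda _ fun i => hXm i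
  have heem : Measurable fun ω => (fun i : s => e i ω) := measurable_pi_lambda _ fun i => hem i
  have hI : IndepFun (fun ω (i : s) => X i ω) (fun ω (i : s) => e i ω) P :=
    hXe.comp (φ := fun x (i : s) => x i) (ψ := fun x (i : s) => x i)
      (measurable_pi_lambda _ fun i => measurable_pi_apply _)
      (measurable_pi_lambda _ fun i => measurable_pi_apply _)
  have hprod := (indepFun_iff_map_prod_eq_prod_map_map hXem.aemeasurable
    heem.aemeasurable).1 hI
  refine (iIndepFun_iff_map_fun_eq_pi_map (f := s.restrict fun i ω => (X i ω, e i ω))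
    fun i => ((hXm i).prodMk (hem i)).aemeasurable).2 ?_
  -- Regrouping coordinates carries the product of two product measures to the product of the laws
  -- of the pairs.
  have mp := (measurePreserving_arrowProdEquivProdArrow E F s (fun i => P.map (X i))
    (fun i => P.map (e i))).symm
  have e1 : (fun ω (i : s) => s.restrict (fun i ω => (X i ω, e i ω)) i ω)
      = (MeasurableEquiv.arrowProdEquivProdArrow E F s).symm ∘
        fun ω => ((fun i : s => X i ω), (fun i : s => e i ω)) := rfl
  rw [e1, ← Measure.map_map (MeasurableEquiv.measurable _) (hXem.prodMk heem), hprod]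
  have hX2 : P.map (fun ω (i : s) => X i ω) = Measure.pi fun i : s => P.map (X i) := hXs'
  have he2 : P.map (fun ω (i : s) => e i ω) = Measure.pi fun i : s => P.map (e i) := hes'
  rw [hX2, he2, mp.map_eq]
  congr 1
  funext i
  exact (hpair i).symm

lemma ProbabilityTheory.IndepFun.identDistrib_prodMk {Ω E F : Type*} [MeasurableSpace Ω]
    [MeasurableSpace E] [MeasurableSpace F] {P : Measure Ω} [IsProbabilityMeasure P]
    {X X' : Ω → E} {e e' : Ω → F} (h : IndepFun X e P) (h' : IndepFun X' e' P)
    (hX : IdentDistrib X X' P P) (he : IdentDistrib e e' P P) :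
    IdentDistrib (fun ω => (X ω, e ω)) (fun ω => (X' ω, e' ω)) P P where
  aemeasurable_fst := hX.aemeasurable_fst.prodMk he.aemeasurable_fst
  aemeasurable_snd := hX.aemeasurable_snd.prodMk he.aemeasurable_snd
  map_eq := by
    rw [(indepFun_iff_map_prod_eq_prod_map_map hX.aemeasurable_fst he.aemeasurable_fst).1 h,
      (indepFun_iff_map_prod_eq_prod_map_map hX.aemeasurable_snd he.aemeasurable_snd).1 h',
      hX.map_eq, he.map_eq]

end Pairs

/-! ### Asymptotic equivalence with the noise sum and its central limit theorem -/

section Estimator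

variable {d : ℕ} {r : ℕ} {K f : EuclideanSpace ℝ (Fin d) → ℝ} {C M B : ℝ}
  {Ω : Type*} [MeasurableSpace Ω] {P : Measure Ω} [IsProbabilityMeasure P]
  {X : ℕ → Ω → EuclideanSpace ℝ (Fin d)} {h : ℕ → ℝ} {b : ℝ}

/-- Here `p` is the estimated density and `m` its truncation, required to agree only where the
weight is nonzero. The terms on the right are the effect of estimating `f` in the noise, the
quadratic remainder, and the linearized quadrature error. -/
lemma sum_div_looDensity_decomposition {n : ℕ} (hn : 0 < n) {p m f y g s e w φ τ : ℕ → ℝ} (I : ℝ)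
    (hy : ∀ i, y i = g i + s i * e i) (hφ : ∀ i, φ i = g i * w i) (hτ : ∀ i, τ i = s i * w i)
    (hm : ∀ i < n, w i ≠ 0 → m i = p i) :
    √(n : ℝ) * ((n : ℝ)⁻¹ * ∑ i ∈ Finset.range n, y i / p i * w i - I)
        - (√(n : ℝ))⁻¹ * ∑ i ∈ Finset.range n, τ i / f i * e i
      = ((√(n : ℝ))⁻¹ * ∑ i ∈ Finset.range n, (τ i * ((m i)⁻¹ - (f i)⁻¹)) * e i)
        + ((√(n : ℝ))⁻¹ * ∑ i ∈ Finset.range n,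
            φ i * ((m i)⁻¹ - (2 / f i - p i / f i ^ 2)))
        + ((√(n : ℝ))⁻¹ * (∑ i ∈ Finset.range n, φ i * (2 / f i - p i / f i ^ 2))
          - √(n : ℝ) * I) := by
  have hn' : (0 : ℝ) < n := by exact_mod_cast hn
  have h1 : √(n : ℝ) * (n : ℝ)⁻¹ = (√(n : ℝ))⁻¹ := by
    have h5 : 0 < √(n : ℝ) := Real.sqrt_pos.2 hn'
    have h4 : (n : ℝ)⁻¹ = (√(n : ℝ))⁻¹ * (√(n : ℝ))⁻¹ := by
      rw [← mul_inv, Real.mul_self_sqrt hn'.le]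
    rw [h4]; field_simp
  rw [mul_sub, ← mul_assoc, h1]
  have h2 : ∑ i ∈ Finset.range n, y i / p i * w i =
      ∑ i ∈ Finset.range n, (τ i * ((m i)⁻¹ - (f i)⁻¹)) * e i
      + ∑ i ∈ Finset.range n, φ i * ((m i)⁻¹ - (2 / f i - p i / f i ^ 2))
      + ∑ i ∈ Finset.range n, φ i * (2 / f i - p i / f i ^ 2)
      + ∑ i ∈ Finset.range n, τ i / f i * e i := by
    simp_rw [← Finset.sum_add_distrib]
    refine Finset.sum_congr rfl fun i hi => ?_
    rw [hy, hφ, hτ]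
    by_cases hw : w i = 0
    · simp [hw]
    · rw [hm i (Finset.mem_range.1 hi) hw]
      simp only [div_eq_mul_inv]
      ring
  rw [h2]
  ring

/-- The scalar estimator is asymptotically equivalent to the normalized noise sum. -/
lemma SmoothingModel.tendstoInMeasure_estimator_sub (hm : SmoothingModel r K f C M B)
    (hX : IsSampleFrom P X f) (hb : 0 < b) (hpos : ∀ᶠ n in atTop, 0 < h n)
    (hs : Tendsto (fun n : ℕ => √(n : ℝ) * h n ^ r) atTop (𝓝 0))
    (hl : Tendsto (fun n : ℕ => √(n : ℝ) * h n ^ d) atTop atTop)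
    {e Y : ℕ → Ω → ℝ} (hem : ∀ i, Measurable (e i))
    (he : iIndepFun e P) (hident : ∀ i, IdentDistrib (e i) (e 0) P P)
    (hXe : IndepFun (fun ω i => X i ω) (fun ω i => e i ω) P)
    (he2 : MemLp (e 0) 2 P) (he0 : ∫ ω, e 0 ω ∂P = 0)
    {g σ w : EuclideanSpace ℝ (Fin d) → ℝ}
    (hY : ∀ i, ∀ᵐ ω ∂P, Y i ω = g (X i ω) + σ (X i ω) * e i ω)
    (hw : ∀ x, w x ≠ 0 → b ≤ f x)
    {T Φ : ℝ} (hτ : IsBoundedWeight f b (fun x => σ x * w x) T)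
    (hφ : IsBoundedWeight f b (fun x => g x * w x) Φ)
    (hcont : ∀ᵐ x ∂(densityMeasure f), ContinuousAt (fun x => g x * w x / f x) x) :
    TendstoInMeasure P (fun (n : ℕ) ω =>
      √(n : ℝ) * ((n : ℝ)⁻¹ * ∑ i ∈ Finset.range n,
          Y i ω / looDensity K (h n) n (fun j => X j ω) i (X i ω) * w (X i ω)
        - ∫ x, g x * w x)
      - (√(n : ℝ))⁻¹ * ∑ i ∈ Finset.range n, σ (X i ω) * w (X i ω) / f (X i ω) * e i ω)
      atTop 0 := by
  refine (((hm.tendstoInMeasure_noise hX hb hpos hs hl hem he hident hXe he2 he0 hτ).add_zero_real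
    (hm.tendstoInMeasure_linearization hX hb hpos hs hl hφ)).add_zero_real
    (hm.tendstoInMeasure_linear hX hb hpos hs hl hφ hcont)).of_eq_off
    (hm.tendsto_measureReal_exists_lt hX hb hpos hs hl) ?_
  filter_upwards [eventually_gt_atTop 0] with n hn
  filter_upwards [ae_all_iff.2 hY] with ω hYω hω
  refine sum_div_looDensity_decomposition hn
    (p := fun i => looDensity K (h n) n (fun j => X j ω) i (X i ω))
    (m := fun i => max (looDensity K (h n) n (fun j => X j ω) i (X i ω)) (b / 2))
    (f := fun i => f (X i ω)) (w := fun i => w (X i ω)) (e := fun i => e i ω)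
    (y := fun i => Y i ω) _ hYω
    (fun i => rfl) (fun i => rfl) fun i hi hwi => max_eq_left ?_
  by_contra hlt
  exact hω ⟨i, hi, hw _ hwi, not_le.1 hlt⟩

/-- Central limit theorem for a noise sum weighted by a bounded function of the design. -/
lemma tendstoInDistribution_weighted_noise (hX : IsSampleFrom P X f)
    {e : ℕ → Ω → ℝ} (hem : ∀ i, Measurable (e i))
    (he : iIndepFun e P) (hident : ∀ i, IdentDistrib (e i) (e 0) P P)
    (hXe : IndepFun (fun ω i => X i ω) (fun ω i => e i ω) P)
    (he2 : MemLp (e 0) 2 P) (he0 : ∫ ω, e 0 ω ∂P = 0)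
    {u : EuclideanSpace ℝ (Fin d) → ℝ} (hu : Measurable u) {U : ℝ} (hU : ∀ x, |u x| ≤ U) :
    MemLp (fun ω => u (X 0 ω) * e 0 ω) 2 P ∧
    TendstoInDistribution (fun (n : ℕ) ω =>
      (√(n : ℝ))⁻¹ * ∑ i ∈ Finset.range n, u (X i ω) * e i ω) atTop id (fun _ => P)
      (gaussianReal 0 Var[fun ω => u (X 0 ω) * e 0 ω; P].toNNReal) := by
  have hXe' : ∀ i, IndepFun (X i) (e i) P := fun i =>
    hXe.comp (measurable_pi_apply i) (measurable_pi_apply i)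
  have hG : Measurable fun p : EuclideanSpace ℝ (Fin d) × ℝ => u p.1 * p.2 :=
    (hu.comp measurable_fst).mul measurable_snd
  have hL : MemLp (fun ω => u (X 0 ω) * e 0 ω) 2 P := by
    refine (he2.const_mul U).mono
      ((hu.comp (hX.measurable 0)).mul (hem 0)).aestronglyMeasurable (ae_of_all _ fun ω => ?_)
    rw [norm_mul, norm_mul]
    gcongr
    exact (hU _).trans (le_abs_self U)
  have h0 : ∫ ω, u (X 0 ω) * e 0 ω ∂P = 0 := by
    have := ((hXe' 0).comp hu measurable_id).integral_fun_mul_eq_mul_integral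
      (hu.comp (hX.measurable 0)).aestronglyMeasurable (hem 0).aestronglyMeasurable
    simp only [Function.comp_def, id] at this
    rw [this, he0, mul_zero]
  refine ⟨hL, ?_⟩
  have hpairs := (hX.indep.prodMk_of_indepFun he hX.measurable hem hXe).comp
    (fun _ p => u p.1 * p.2) fun _ => hG
  have hid : ∀ i, IdentDistrib (fun ω => u (X i ω) * e i ω) (fun ω => u (X 0 ω) * e 0 ω) P P :=
    fun i => ((hXe' i).identDistrib_prodMk (hXe' 0)
      ⟨(hX.measurable i).aemeasurable, (hX.measurable 0).aemeasurable,
        (hX.law i).map_eq.trans (hX.law 0).map_eq.symm⟩ (hident i)).comp hG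
  have := tendstoInDistribution_inv_sqrt_mul_sum_sub (P := P)
    (X := fun i ω => u (X i ω) * e i ω) (Y := id)
    (P' := gaussianReal 0 Var[fun ω => u (X 0 ω) * e 0 ω; P].toNNReal)
    ⟨aemeasurable_id, Measure.map_id⟩ hL hpairs hid
  simpa only [h0, mul_zero, sub_zero] using this

end Estimator

/-! ### Boundedness and continuity of Hölder functions -/

section Holder

lemma IsHolderOn.continuousOn {E F : Type*} [PseudoEMetricSpace E] [PseudoEMetricSpace F]
    {u : E → F} {s : Set E} (hu : IsHolderOn u s) : ContinuousOn u s := by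
  obtain ⟨C, α, h0, -, h⟩ := hu
  exact h.continuousOn h0

lemma IsHolderOn.exists_norm_le {E F : Type*} [PseudoMetricSpace E] [SeminormedAddCommGroup F]
    {u : E → F} {s : Set E} (hu : IsHolderOn u s) (hs : Bornology.IsBounded s) :
    ∃ M, 0 ≤ M ∧ ∀ x ∈ s, ‖u x‖ ≤ M := by
  obtain ⟨C, α, h0, -, h⟩ := hu
  obtain ⟨D, hD⟩ := Metric.isBounded_iff.1 hs
  rcases s.eq_empty_or_nonempty with rfl | ⟨y, hy⟩
  · exact ⟨0, le_rfl, by simp⟩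
  have hD0 : 0 ≤ D := dist_nonneg.trans (hD hy hy)
  refine ⟨C * D ^ (α : ℝ) + ‖u y‖, by positivity, fun x hx => ?_⟩
  have h1 : dist (u x) (u y) ≤ C * D ^ (α : ℝ) := h.dist_le_of_le hx hy (hD hx hy)
  rw [dist_eq_norm] at h1
  calc ‖u x‖ = ‖u x - u y + u y‖ := by rw [sub_add_cancel]
    _ ≤ _ := (norm_add_le _ _).trans (by gcongr)

end Holder

/-! ### Discarding the boundary of a convex set -/

section Interior

variable {d : ℕ} {F : Type*} [NormedAddCommGroup F] {Q : Set (EuclideanSpace ℝ (Fin d))}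
  {u : EuclideanSpace ℝ (Fin d) → F}

/-- A convex set need not be Borel, so a function continuous on `Q` and zero outside need not be
Borel either. Cutting down to the open interior repairs this. -/
lemma measurable_indicator_interior [MeasurableSpace F] [BorelSpace F]
    (hu : ContinuousOn u Q) : Measurable ((interior Q).indicator u) := by
  classical
  rw [← Set.piecewise_eq_indicator]
  exact (hu.mono interior_subset).measurable_piecewise continuousOn_const
    isOpen_interior.measurableSet

/-- The frontier of a convex set is Lebesgue-null. Almost every point is therefore one where a
function vanishing off `Q` is either continuous, if it is so on `Q`, or locally zero. -/
lemma Convex.ae_mem_interior_or_notMem_closure (hQ : Convex ℝ Q) :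
    ∀ᵐ x, x ∈ interior Q ∨ x ∉ closure Q := by
  have := measure_eq_zero_iff_ae_notMem.1 (hQ.addHaar_frontier volume)
  filter_upwards [this] with x hx
  by_contra! hc
  exact hx ⟨hc.2, hc.1⟩

lemma Convex.ae_eq_indicator_interior (hQ : Convex ℝ Q) (hu : ∀ x, x ∉ Q → u x = 0) :
    ∀ᵐ x, u x = (interior Q).indicator u x := by
  filter_upwards [hQ.ae_mem_interior_or_notMem_closure] with x hx
  rcases hx with hx | hx
  · rw [Set.indicator_of_mem hx]
  · rw [Set.indicator_of_notMem fun h => hx (subset_closure (interior_subset h)),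
      hu x fun h => hx (subset_closure h)]

lemma norm_indicator_interior_le {M : ℝ} (h0 : 0 ≤ M) (hM : ∀ x ∈ Q, ‖u x‖ ≤ M)
    (x : EuclideanSpace ℝ (Fin d)) : ‖(interior Q).indicator u x‖ ≤ M := by
  rw [norm_indicator_eq_indicator_norm]
  exact Set.indicator_apply_le' (fun h => hM x (interior_subset h)) fun _ => h0

lemma integrable_of_norm_le_of_eq_zero (hQ : Bornology.IsBounded Q)
    (hu : AEStronglyMeasurable u volume) {M : ℝ} (hM : ∀ x ∈ interior Q, ‖u x‖ ≤ M)
    (h0 : ∀ x, x ∉ interior Q → u x = 0) : Integrable u := by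
  refine IntegrableOn.integrable_of_forall_notMem_eq_zero (s := interior Q) ?_ h0
  refine IntegrableOn.of_bound ((hQ.subset interior_subset).measure_lt_top)
    hu.restrict M ?_
  exact (ae_restrict_mem isOpen_interior.measurableSet).mono hM

end Interior

lemma HasBoundedDerivOfOrder.continuous {d r : ℕ} {f : EuclideanSpace ℝ (Fin d) → ℝ}
    (hf : HasBoundedDerivOfOrder r f) (hr : 1 ≤ r) : Continuous f := by
  have h := (hf.1 0 hr).continuous
  have e : f = fun x => iteratedFDeriv ℝ 0 f x 0 := by
    funext x; rw [iteratedFDeriv_zero_apply]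
  rw [e]
  exact (ContinuousMultilinearMap.apply ℝ _ ℝ (0 : Fin 0 → EuclideanSpace ℝ (Fin d))).continuous.comp h

/-- For `r = 0` the sequence would be `√n`, which diverges. A positive order is needed for the
continuity of `f` and for the bias bound. -/
lemma one_le_of_tendsto_sqrt_mul_pow {r : ℕ} {h : ℕ → ℝ}
    (hs : Tendsto (fun n : ℕ => √(n : ℝ) * h n ^ r) atTop (𝓝 0)) : 1 ≤ r := by
  by_contra! hr
  obtain rfl : r = 0 := by omega
  simp only [pow_zero, mul_one] at hs
  exact not_tendsto_nhds_of_tendsto_atTop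
    (Real.tendsto_sqrt_atTop.comp tendsto_natCast_atTop_atTop) 0 hs

/-! ### Covariance matrices and the Cramér–Wold device -/

section Gaussian

variable {d : ℕ} {Ω : Type*} [MeasurableSpace Ω] {P : Measure Ω}

lemma variance_inner_eq_dotProduct [IsProbabilityMeasure P]
    {Z : Ω → EuclideanSpace ℝ (Fin d)} (hZ : MemLp Z 2 P)
    (t : EuclideanSpace ℝ (Fin d)) :
    t.ofLp ⬝ᵥ (covarianceMatrix Z P).mulVec t.ofLp = Var[fun ω => inner ℝ (Z ω) t; P] := by
  have hZi : ∀ i, MemLp (fun ω => Z ω i) 2 P := fun i =>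
    hZ.mono ((by fun_prop : Measurable fun x : EuclideanSpace ℝ (Fin d) =>
      x i).comp_aemeasurable hZ.aemeasurable).aestronglyMeasurable
      (ae_of_all _ fun ω => PiLp.norm_apply_le (Z ω) i)
  have e : (fun ω => inner ℝ (Z ω) t) = fun ω => ∑ i, t i * Z ω i := by
    funext ω
    simp [PiLp.inner_apply]
  rw [e, ← covariance_self, covariance_fun_sum_fun_sum]
  · simp only [dotProduct, Matrix.mulVec, covarianceMatrix, Matrix.of_apply,
      covariance_const_mul_left, covariance_const_mul_right, Finset.mul_sum]
    refine Finset.sum_congr rfl fun i _ => Finset.sum_congr rfl fun j _ => ?_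
    ring
  · exact fun i => (hZi i).const_mul _
  · exact fun i => (hZi i).const_mul _
  · exact Finset.aemeasurable_fun_sum _ fun i _ => ((hZi i).const_mul _).aemeasurable

lemma posSemidef_covarianceMatrix [IsProbabilityMeasure P]
    {Z : Ω → EuclideanSpace ℝ (Fin d)} (hZ : MemLp Z 2 P) :
    (covarianceMatrix Z P).PosSemidef := by
  refine Matrix.PosSemidef.of_dotProduct_mulVec_nonneg ?_ fun x => ?_
  · ext i j
    simp [covarianceMatrix, covariance_comm]
  · have := variance_inner_eq_dotProduct hZ (WithLp.toLp 2 x)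
    simp only [star_trivial]
    rw [show x = (WithLp.toLp 2 x).ofLp from rfl, this]
    exact variance_nonneg _ _

/-- This is the Cramér–Wold reduction: evaluating the characteristic functions of one-dimensional
projections at 1 recovers the multivariate one. -/
lemma charFun_map_inner {T : Ω → EuclideanSpace ℝ (Fin d)} (hT : AEMeasurable T P)
    (t : EuclideanSpace ℝ (Fin d)) :
    charFun (P.map T) t = charFun (P.map fun ω => inner ℝ (T ω) t) 1 := by
  have h1 : AEMeasurable (fun ω => inner ℝ (T ω) t) P := hT.inner_const
  rw [charFun_apply, charFun_apply, integral_map hT (by fun_prop), integral_map h1 (by fun_prop)]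
  simp

/-- Cramér–Wold device for a centered Gaussian limit. -/
lemma tendstoInDistribution_multivariateGaussian [IsProbabilityMeasure P]
    {T : ℕ → Ω → EuclideanSpace ℝ (Fin d)}
    (hT : ∀ n, AEMeasurable (T n) P) {Z : Ω → EuclideanSpace ℝ (Fin d)} (hZ : MemLp Z 2 P)
    (h : ∀ t, TendstoInDistribution (fun n ω => inner ℝ (T n ω) t) atTop id (fun _ => P)
      (gaussianReal 0 Var[fun ω => inner ℝ (Z ω) t; P].toNNReal)) :
    TendstoInDistribution T atTop id (fun _ => P)
      (multivariateGaussian 0 (covarianceMatrix Z P)) where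
  forall_aemeasurable := hT
  aemeasurable_limit := aemeasurable_id
  tendsto := by
    refine ProbabilityMeasure.tendsto_iff_tendsto_charFun.2 fun t => ?_
    have ht := ProbabilityMeasure.tendsto_iff_tendsto_charFun.1 (h t).tendsto 1
    simp only [ProbabilityMeasure.coe_mk, Measure.map_id] at ht ⊢
    rw [charFun_gaussianReal] at ht
    rw [charFun_multivariateGaussian (posSemidef_covarianceMatrix hZ),
      variance_inner_eq_dotProduct hZ]
    simp_rw [charFun_map_inner (hT _)]
    simpa [variance_nonneg] using ht

end Gaussian

/-! ### Weights built from the restricted gradient -/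

section Weights

variable {d : ℕ} {f v : EuclideanSpace ℝ (Fin d) → ℝ} {Q : Set (EuclideanSpace ℝ (Fin d))} {b : ℝ}
  {G : EuclideanSpace ℝ (Fin d) → EuclideanSpace ℝ (Fin d)}

/-- A function bounded on `Q` times a component of a bounded field supported in `interior Q`. -/
lemma isBoundedWeight_mul_inner_indicator (hv : Measurable v) {V Γ : ℝ} (hΓ0 : 0 ≤ Γ)
    (hV : ∀ x ∈ Q, |v x| ≤ V) (hV0 : 0 ≤ V) (hG : ContinuousOn G Q) (hΓ : ∀ x ∈ Q, ‖G x‖ ≤ Γ)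
    (hf : ∀ x ∈ Q, b ≤ f x) (t : EuclideanSpace ℝ (Fin d)) :
    IsBoundedWeight f b (fun x => v x * inner ℝ ((interior Q).indicator G x) t)
      (V * (Γ * ‖t‖)) where
  measurable := hv.mul ((measurable_indicator_interior hG).inner_const)
  bdd x := by
    by_cases hx : x ∈ interior Q
    · rw [abs_mul]
      gcongr
      · exact hV x (interior_subset hx)
      · refine (abs_real_inner_le_norm _ _).trans ?_
        gcongr
        exact norm_indicator_interior_le hΓ0 hΓ x
    · simp only [Set.indicator_of_notMem hx, inner_zero_left, mul_zero, abs_zero]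
      positivity
  support x hx := by
    by_contra hlt
    have : x ∉ interior Q := fun h => hlt (hf x (interior_subset h))
    simp [Set.indicator_of_notMem this] at hx

lemma Convex.ae_continuousAt_mul_inner_indicator_div (hQ : Convex ℝ Q) (hv : ContinuousOn v Q)
    (hG : ContinuousOn G Q) (hfc : Continuous f) (hb : 0 < b) (hf : ∀ x ∈ Q, b ≤ f x)
    (t : EuclideanSpace ℝ (Fin d)) :
    ∀ᵐ x, ContinuousAt (fun x => v x * inner ℝ ((interior Q).indicator G x) t / f x) x := by
  filter_upwards [hQ.ae_mem_interior_or_notMem_closure] with x hx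
  rcases hx with hx | hx
  · have hQx : Q ∈ 𝓝 x := mem_interior_iff_mem_nhds.1 hx
    have hG' : ContinuousAt ((interior Q).indicator G) x := by
      refine (hG.continuousAt hQx).congr ?_
      filter_upwards [isOpen_interior.mem_nhds hx] with y hy
      rw [Set.indicator_of_mem hy]
    have hfx : f x ≠ 0 := (hb.trans_le (hf x (interior_subset hx))).ne'
    exact ((hv.continuousAt hQx).mul (hG'.inner continuousAt_const)).div hfc.continuousAt hfx
  · refine (continuousAt_const (y := (0 : ℝ))).congr ?_
    filter_upwards [isClosed_closure.isOpen_compl.mem_nhds hx] with y hy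
    rw [Set.indicator_of_notMem fun h => hy (subset_closure (interior_subset h))]
    simp

end Weights

/-! ### Projection of the estimator on a direction -/

section Projection

variable {d : ℕ}

lemma inner_betaHat (K : EuclideanSpace ℝ (Fin d) → ℝ) (a : ℝ)
    (G : EuclideanSpace ℝ (Fin d) → EuclideanSpace ℝ (Fin d)) (n : ℕ)
    (x : ℕ → EuclideanSpace ℝ (Fin d)) (y : ℕ → ℝ) (t : EuclideanSpace ℝ (Fin d)) :
    inner ℝ (betaHat K a G n x y) t = (n : ℝ)⁻¹ * ∑ i ∈ Finset.range n,
      y i / looDensity K a n x i (x i) * inner ℝ (G (x i)) t := by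
  simp [betaHat, real_inner_smul_left, sum_inner]

end Projection

/-! ### The main theorem -/

theorem corollary1 {d : ℕ} (hd : 1 ≤ d)
    {Ω : Type*} [MeasurableSpace Ω] (P : Measure Ω) [IsProbabilityMeasure P]
    -- the model `Y i = g (X i) + σ (X i) e i`
    (X : ℕ → Ω → EuclideanSpace ℝ (Fin d)) (e Y : ℕ → Ω → ℝ)
    (g σ : EuclideanSpace ℝ (Fin d) → ℝ)
    (hX_meas : ∀ i, Measurable (X i)) (he_meas : ∀ i, Measurable (e i))
    (hg_meas : Measurable g) (hσ_meas : Measurable σ)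
    (hX_indep : iIndepFun X P)
    (he_indep : iIndepFun e P) (he_ident : ∀ i, IdentDistrib (e i) (e 0) P P)
    (hXe_indep : IndepFun (fun ω i => X i ω) (fun ω i => e i ω) P)
    (he_sq : MemLp (e 0) 2 P) (he_mean : ∫ ω, e 0 ω ∂P = 0)
    (hY : ∀ i, ∀ᵐ ω ∂P, Y i ω = g (X i ω) + σ (X i ω) * e i ω)
    -- every `X i` has the bounded density `f`, whose derivatives of order `r` are bounded
    (r : ℕ) (f : EuclideanSpace ℝ (Fin d) → ℝ) (hf_nonneg : ∀ x, 0 ≤ f x)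
    (hX_law : ∀ i, HasLaw (X i) (volume.withDensity fun x => ENNReal.ofReal (f x)) P)
    (hf_bdd : ∃ M : ℝ, ∀ x, f x ≤ M) (hf_deriv : HasBoundedDerivOfOrder r f)
    -- the density is bounded away from zero on `Q`
    (Q : Set (EuclideanSpace ℝ (Fin d))) (hf_lower : ∃ b : ℝ, 0 < b ∧ ∀ x ∈ Q, b ≤ f x)
    -- the kernel
    (K : EuclideanSpace ℝ (Fin d) → ℝ) (hK : IsKernelOfOrder r K)
    -- the test function `ψ`; its gradient vanishes off the bounded convex set `Q` and is
    -- Hölder on `Q`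
    (ψ : EuclideanSpace ℝ (Fin d) → ℝ)
    (gradψ : EuclideanSpace ℝ (Fin d) → EuclideanSpace ℝ (Fin d))
    (hgradψ : ∀ᵐ x, HasGradientAt ψ (gradψ x) x)
    (hQ_nonempty : Q.Nonempty) (hQ_bdd : Bornology.IsBounded Q) (hQ_conv : Convex ℝ Q)
    (hψ_supp : ∀ x, x ∉ Q → gradψ x = 0) (hψ_holder : IsHolderOn gradψ Q)
    -- the regression function and the noise level
    (hg_holder : IsHolderOn g Q) (hσ_bdd : ∃ M : ℝ, ∀ x, |σ x| ≤ M)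
    -- the bandwidth
    (h : ℕ → ℝ) (hh_pos : ∀ᶠ n in atTop, 0 < h n)
    (hh_small : Tendsto (fun n : ℕ => √(n : ℝ) * h n ^ r) atTop (𝓝 0))
    (hh_large : Tendsto (fun n : ℕ => √(n : ℝ) * h n ^ d) atTop atTop) :
    Integrable (fun x => g x • gradψ x) ∧
    MemLp (fun ω => ((Y 0 ω - g (X 0 ω)) / f (X 0 ω)) • gradψ (X 0 ω)) 2 P ∧
    TendstoInDistribution
      (fun (n : ℕ) (ω : Ω) =>
        √(n : ℝ) • (betaHat K (h n) gradψ n (fun i => X i ω) (fun i => Y i ω)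
          - ∫ x, g x • gradψ x))
      atTop id (fun _ => P)
      (multivariateGaussian 0 (covarianceMatrix
        (fun ω => ((Y 0 ω - g (X 0 ω)) / f (X 0 ω)) • gradψ (X 0 ω)) P)) := by
  have hr := one_le_of_tendsto_sqrt_mul_pow hh_small
  have hfc := hf_deriv.continuous hr
  obtain ⟨b, hb, hfb⟩ := hf_lower
  obtain ⟨M, hM⟩ := hf_bdd
  obtain ⟨C, -, hC⟩ := hK.exists_bound
  obtain ⟨B, -, hB⟩ := hK.exists_bias_bound hr hf_deriv hfc.measurable (M := M)
    fun x => by rw [abs_of_nonneg (hf_nonneg x)]; exact hM x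
  have hm : SmoothingModel r K f C M B := ⟨hK, hfc.measurable, hf_nonneg, hC, hM, hB⟩
  have hX : IsSampleFrom P X f := ⟨hX_indep, hX_meas, hX_law⟩
  obtain ⟨Γ, hΓ0, hΓ⟩ := hψ_holder.exists_norm_le hQ_bdd
  obtain ⟨V, hV0, hV⟩ := hg_holder.exists_norm_le hQ_bdd
  obtain ⟨S, hS⟩ := hσ_bdd
  have hS0 : 0 ≤ S := (abs_nonneg _).trans (hS 0)
  have hGc := hψ_holder.continuousOn
  -- `G` is Borel, continuous almost everywhere and equal to `gradψ` almost everywhere. Since the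
  -- design has a density, the two also agree almost surely at every sample point.
  set G := (interior Q).indicator gradψ with hG
  have hGm : Measurable G := measurable_indicator_interior hGc
  have hGae : ∀ᵐ x, gradψ x = G x := hQ_conv.ae_eq_indicator_interior hψ_supp
  have hac : densityMeasure f ≪ volume := withDensity_absolutelyContinuous _ _
  have hGX : ∀ i, ∀ᵐ ω ∂P, gradψ (X i ω) = G (X i ω) := fun i => by
    refine ae_of_ae_map (p := fun x => gradψ x = G x) (hX_meas i).aemeasurable ?_
    rw [(hX_law i).map_eq]
    exact hac.ae_le hGae
  -- integrability of the target
  have hint' : Integrable fun x => g x • G x := by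
    refine integrable_of_norm_le_of_eq_zero hQ_bdd (hg_meas.smul hGm).aestronglyMeasurable
      (M := V * Γ) (fun x hx => ?_) fun x hx => ?_
    · rw [norm_smul]
      gcongr
      · exact hV x (interior_subset hx)
      · exact norm_indicator_interior_le hΓ0 hΓ x
    · rw [hG, Set.indicator_of_notMem hx, smul_zero]
  have hgG : (fun x => g x • gradψ x) =ᵐ[volume] fun x => g x • G x := by
    filter_upwards [hGae] with x hx
    rw [hx]
  have hint : Integrable fun x => g x • gradψ x := hint'.congr hgG.symm
  -- the limiting noise vector
  have hXe0 : ∀ i, Measurable fun ω => σ (X i ω) / f (X i ω) * e i ω := fun i =>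
    ((hσ_meas.comp (hX_meas i)).div (hfc.measurable.comp (hX_meas i))).mul (he_meas i)
  set Z : Ω → EuclideanSpace ℝ (Fin d) :=
    fun ω => ((Y 0 ω - g (X 0 ω)) / f (X 0 ω)) • gradψ (X 0 ω) with hZ
  have hZae : Z =ᵐ[P] fun ω => (σ (X 0 ω) / f (X 0 ω) * e 0 ω) • G (X 0 ω) := by
    filter_upwards [hY 0, hGX 0] with ω h1 h2
    simp only [hZ]
    rw [h1, h2]
    congr 1
    ring
  have hZL : MemLp Z 2 P := by
    refine MemLp.ae_eq hZae.symm ?_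
    refine (he_sq.const_mul (S / b * Γ)).mono
      ((hXe0 0).smul (hGm.comp (hX_meas 0))).aestronglyMeasurable (ae_of_all _ fun ω => ?_)
    by_cases hx : X 0 ω ∈ interior Q
    · have hfx := hfb _ (interior_subset hx)
      rw [norm_smul, norm_mul, norm_div, norm_mul, Real.norm_of_nonneg (by positivity :
        0 ≤ S / b * Γ), Real.norm_of_nonneg (hf_nonneg _), mul_right_comm]
      gcongr
      · exact hS _
      · exact norm_indicator_interior_le hΓ0 hΓ _
    · rw [hG, Set.indicator_of_notMem hx, smul_zero, norm_zero]
      exact norm_nonneg _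
  refine ⟨hint, hZL, ?_⟩
  have hYm : ∀ i, AEMeasurable (Y i) P := fun i =>
    (((hg_meas.comp (hX_meas i)).add ((hσ_meas.comp (hX_meas i)).mul
      (he_meas i))).aemeasurable).congr ((hY i).mono fun ω h => h.symm)
  have hTm : ∀ n : ℕ, AEMeasurable (fun ω => √(n : ℝ) •
      (betaHat K (h n) gradψ n (fun i => X i ω) (fun i => Y i ω) - ∫ x, g x • gradψ x)) P := by
    intro n
    have hsum : AEMeasurable (fun ω => ∑ i ∈ Finset.range n,
        (Y i ω / looDensity K (h n) n (fun j => X j ω) i (X i ω)) • gradψ (X i ω)) P := by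
      refine Finset.aemeasurable_fun_sum _ fun i _ => ?_
      exact ((hYm i).div (hX.measurable_looDensity hK.measurable (h n) n i).aemeasurable).smul
        ((hGm.comp (hX_meas i)).aemeasurable.congr ((hGX i).mono fun ω h => h.symm))
    exact ((hsum.const_smul (n : ℝ)⁻¹).sub_const _).const_smul √(n : ℝ)
  -- From here the problem is scalar, with weight `w x = inner ℝ (G x) t`.
  refine tendstoInDistribution_multivariateGaussian hTm hZL fun t => ?_
  have hτ : IsBoundedWeight f b (fun x => σ x * inner ℝ (G x) t) (S * (Γ * ‖t‖)) :=
    isBoundedWeight_mul_inner_indicator hσ_meas hΓ0 (fun x _ => hS x) hS0 hGc hΓ hfb t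
  have hφ : IsBoundedWeight f b (fun x => g x * inner ℝ (G x) t) (V * (Γ * ‖t‖)) :=
    isBoundedWeight_mul_inner_indicator hg_meas hΓ0 hV hV0 hGc hΓ hfb t
  have hcont := hac.ae_le (hQ_conv.ae_continuousAt_mul_inner_indicator_div hg_holder.continuousOn
    hGc hfc hb hfb t)
  have hw : ∀ x, inner ℝ (G x) t ≠ 0 → b ≤ f x := fun x hx => by
    refine hfb x ?_
    by_contra hxQ
    exact hx (by rw [hG, Set.indicator_of_notMem fun h => hxQ (interior_subset h), inner_zero_left])
  have hsub := hm.tendstoInMeasure_estimator_sub hX hb hh_pos hh_small hh_large he_meas he_indep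
    he_ident hXe_indep he_sq he_mean hY hw hτ hφ hcont
  have hclt := (tendstoInDistribution_weighted_noise hX he_meas he_indep he_ident hXe_indep he_sq
    he_mean (u := fun x => σ x * inner ℝ (G x) t / f x) (hτ.measurable.div hfc.measurable)
    (fun x => by simpa using hτ.abs_div_pow_le hb 1 x)).2
  have hvar : Var[fun ω => σ (X 0 ω) * inner ℝ (G (X 0 ω)) t / f (X 0 ω) * e 0 ω; P]
      = Var[fun ω => inner ℝ (Z ω) t; P] := by
    refine variance_congr ?_
    filter_upwards [hZae] with ω hω
    rw [hω, real_inner_smul_left]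
    ring
  rw [hvar] at hclt
  have hI : inner ℝ (∫ x, g x • gradψ x) t = ∫ x, g x * inner ℝ (G x) t := by
    rw [integral_congr_ae hgG, real_inner_comm, ← integral_inner hint']
    refine integral_congr_ae (ae_of_all _ fun x => ?_)
    simp only [real_inner_smul_right, real_inner_comm]
  -- Slutsky: the projected error differs from the noise sum by a term vanishing in probability, so
  -- it inherits the Gaussian limit.
  refine tendstoInDistribution_of_tendstoInMeasure_sub _ _ hclt (hsub.congr_left fun n => ?_)
    fun n => (hTm n).inner_const
  filter_upwards [ae_all_iff.2 hGX] with ω hω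
  simp only [Pi.sub_apply]
  rw [real_inner_smul_left, inner_sub_left, inner_betaHat, hI]
  simp only [hω]
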